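/- **Conventions.** A *bar partition* is a partition $\lambda=(a_1>\dots>a_m>0)$ into distinct parts (the empty one is allowed); $m(\lambda)=m$ is its number of parts and $\mathcal P(\lambda)$ its set of parts. Unions and differences of multisets are taken with multiplicities added and subtracted. The multiset of bar lengths of $\lambda$ is $$\mathcal B(\lambda)=\bigcup_{1\le i\le m}\{1,\dots,a_i\}\cup\{a_i+a_j\mid j>i\}\setminus\{a_i-a_j\mid j>i\}.$$ Removing a bar of length $\ell$ from $\lambda$ means: replacing a part $a>\ell$ by $a-\ell$, where $a-\ell$ is not a part of $\lambda$; or deleting a part equal to $\ell$; or deleting two distinct parts with sum $\ell$. Let $d$ be odd. The $\bar d$-*core* $\bar c_d(\lambda)$ is the (unique) bar partition obtained from $\lambda$ by removing bars of length divisible by $d$ until there are none left. Let $D(\lambda)=(a_1,\dots,a_m\mid a_1-1,\dots,a_m-1)$ (Frobenius notation) be the doubled partition, and let $X$ be its $\beta$-set whose cardinality is the least multiple of $d$ that is at least the number of parts of $D(\lambda)$, displayed on a $d$-abacus with runners $0,\dots,d-1$; let $x_i$ be the number of beads on runner $i$, i.e. of elements of $X$ congruent to $i$ modulo $d$. The $\bar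 d$-*quotient* of $\lambda$ is $(\mu_0,\mu_1,\dots,\mu_{(d-1)/2})$, where the parts of $\mu_0$ are the numbers $a/d$ for the parts $a$ of $\lambda$ divisible by $d$, and, for $1\le i\le (d-1)/2$, $\mu_i$ is the partition whose $\beta$-set is given by the bead positions on runner $i$. The $\bar d$-*quotient partition* $\bar q_d(\lambda)$ is the (unique) bar partition with empty $\bar d$-core and the same $\bar d$-quotient as $\lambda$. Let $\mu=\bar q_d(\lambda)$. The node in row $r$ and column $c$ of the Young diagram of $D(\mu)$ has $d$-residue $c-r$ modulo $d$. The bars of $\mu$ are the hooks of $D(\mu)$ at the nodes $(r,c)$ with $r<c$; those among them with $c=m(\mu)+1$ correspond to the parts of $\mu$ (and have the parts as lengths). If such a hook $z$ has length $h(z)$, hand node (the end of its row) of residue $i$ and foot node (the end of its column) of residue congruent to $j+1$, where $0\le i,j\le d-1$, its modified length is $\bar h(z)=h(z)+d(x_i-x_j)$, where $x_0,\dots,x_{d-1}$ are the bead numbers of $D(\lambda)$. Let $\bar{\mathcal B}(\bar q_d(\lambda))$ be the multiset of the $|\bar h(z)|$ for all bars $z$ of $\mu$, and $\bar{\mathcal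 P}(\bar q_d(\lambda))$ the set of the $|\bar h(z)|$ for the hooks $z$ corresponding to the parts of $\mu$. **Corollary 4.2.** For any bar partition $\lambda$ and any odd integer $d\ge 3$, the following hold. 1. $\mathcal B(\bar c_d(\lambda))\subset\mathcal B(\lambda)$ (as multisets). 2. $\bar{\mathcal B}(\bar q_d(\lambda))\subset\mathcal B(\lambda)$ (as multisets). 3. $\mathcal P(\lambda)$ is the symmetric difference of $\mathcal P(\bar c_d(\lambda))$ and $\bar{\mathcal P}(\bar q_d(\lambda))$. 4. $m(\bar c_d(\lambda))+m(\bar q_d(\lambda))=m(\lambda)+2\,|\mathcal P(\bar c_d(\lambda))\cap\bar{\mathcal P}(\bar q_d(\lambda))|$. 5. $\mathcal B(\lambda)=\mathcal B(\bar c_d(\lambda))\cup\bar{\mathcal B}(\bar q_d(\lambda))$ (as multisets) if and only if $m(\lambda)=m(\bar c_d(\lambda))+m(\bar q_d(\lambda))$. -/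

import Mathlib

/-- A bar partition: a partition into distinct positive parts, given by its set of parts. -/
@[ext]
structure BarPartition where
  /-- The set of parts. -/
  parts : Finset ℕ
  zero_notMem : 0 ∉ parts

namespace BarPartition

/-- The number `m(λ)` of parts of `λ`. -/
def numParts (lam : BarPartition) : ℕ := lam.parts.card

/-- The multiset `ℬ(λ)` of bar lengths of `λ = (a₁ > ⋯ > aₘ > 0)`: the multiset union over `i` of
`{1, …, aᵢ} ∪ {aᵢ + aⱼ | j > i} ∖ {aᵢ - aⱼ | j > i}`. -/
def barLengths (lam : BarPartition) : Multiset ℕ :=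
  ∑ a ∈ lam.parts,
    ((Finset.Icc 1 a).val + (lam.parts.filter (· < a)).val.map (fun b => a + b)
      - (lam.parts.filter (· < a)).val.map (fun b => a - b))

/-! ### The bar core -/

/-- `mu` arises from `lam` by removing a bar of length `l`: a part `a > l` is replaced by `a - l`
(not already a part), or a part equal to `l` is removed, or two distinct parts of sum `l` are
removed. -/
def RemovesBar (l : ℕ) (lam mu : BarPartition) : Prop :=
  (∃ a ∈ lam.parts, l < a ∧ a - l ∉ lam.parts ∧
    mu.parts = insert (a - l) (lam.parts.erase a)) ∨
  (l ∈ lam.parts ∧ mu.parts = lam.parts.erase l) ∨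
  (∃ a ∈ lam.parts, ∃ b ∈ lam.parts, b < a ∧ a + b = l ∧
    mu.parts = (lam.parts.erase a).erase b)

/-- `c` is obtained from `lam` by removing all the bars of length divisible by `d`: it is reached
by successive removals of such bars, and no such bar is left in it. -/
def IsBarCore (d : ℕ) (lam c : BarPartition) : Prop :=
  Relation.ReflTransGen (fun mu nu => ∃ l, d ∣ l ∧ RemovesBar l mu nu) lam c ∧
    ∀ l nu, d ∣ l → ¬ RemovesBar l c nu

/-! ### The doubled partition and its abacus -/

/-- The parts in decreasing order, indexed from `0`: `lam.part i` is `a_{i+1}` for `i < m`,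
and it is `0` for `i ≥ m`. -/
def part (lam : BarPartition) (i : ℕ) : ℕ := (lam.parts.sort (· ≥ ·)).getD i 0

theorem part_eq_zero (lam : BarPartition) {i : ℕ} (h : lam.numParts ≤ i) : lam.part i = 0 := by
  unfold part
  apply List.getD_eq_default
  simpa [numParts] using h

theorem part_mem (lam : BarPartition) {i : ℕ} (h : i < lam.numParts) : lam.part i ∈ lam.parts := by
  unfold part
  have h2 : i < (lam.parts.sort (· ≥ ·)).length := by simpa [numParts] using h
  rw [List.getD_eq_getElem _ _ h2]
  exact (Finset.mem_sort (· ≥ ·)).1 (List.getElem_mem h2)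

theorem part_pos (lam : BarPartition) {i : ℕ} (h : i < lam.numParts) : 0 < lam.part i :=
  Nat.pos_of_ne_zero fun h0 => lam.zero_notMem (h0 ▸ lam.part_mem h)

theorem part_lt (lam : BarPartition) {i j : ℕ} (hij : i < j) (h : j < lam.numParts) :
    lam.part j < lam.part i := by
  unfold part
  have hj : j < (lam.parts.sort (· ≥ ·)).length := by simpa [numParts] using h
  rw [List.getD_eq_getElem _ _ hj, List.getD_eq_getElem _ _ (hij.trans hj)]
  exact List.pairwise_iff_getElem.1 (Finset.sortedGT_sort lam.parts).pairwise i j _ hj hij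

theorem exists_part (lam : BarPartition) {a : ℕ} (h : a ∈ lam.parts) :
    ∃ i < lam.numParts, lam.part i = a := by
  have h1 : a ∈ lam.parts.sort (· ≥ ·) := (Finset.mem_sort (· ≥ ·)).2 h
  obtain ⟨i, hi, rfl⟩ := List.getElem_of_mem h1
  refine ⟨i, by simpa [numParts] using hi, ?_⟩
  unfold part
  rw [List.getD_eq_getElem _ _ hi]

theorem add_part_anti (lam : BarPartition) {i j : ℕ} (hij : i ≤ j) (h : j < lam.numParts) :
    j + lam.part j ≤ i + lam.part i := by
  induction j, hij using Nat.le_induction with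
  | base => exact le_rfl
  | succ n hn ih =>
    have h1 := lam.part_lt (Nat.lt_add_one n) h
    have h2 := ih (by omega)
    omega

/-- The Young diagram of the doubled partition `D(λ) = (a₁, …, aₘ | a₁ - 1, …, aₘ - 1)` in
Frobenius notation. Rows and columns are indexed from `0`; in row `i` there are `part i` nodes to
the right of the diagonal node, and in column `j` there are `part j - 1` nodes below it. The nodes
`(i, j)` with `i < j` form the shifted diagram `S(λ)`. -/
def double (lam : BarPartition) : YoungDiagram where
  cells := ((Finset.range (lam.numParts + lam.part 0 + 1)) ×ˢ
      (Finset.range (lam.numParts + lam.part 0 + 1))).filter fun z =>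
    (z.1 < z.2 ∧ z.2 ≤ z.1 + lam.part z.1) ∨ (z.2 ≤ z.1 ∧ z.1 < z.2 + lam.part z.2)
  isLowerSet := by
    rintro ⟨i, j⟩ ⟨i', j'⟩ ⟨hi, hj⟩ h
    simp only [Finset.coe_filter, Finset.mem_product, Finset.mem_range, Set.mem_ofPred_eq] at *
    obtain ⟨⟨h1, h2⟩, h3⟩ := h
    refine ⟨⟨by omega, by omega⟩, ?_⟩
    have key : ∀ k, 0 < lam.part k → k < lam.numParts := fun k hk => by
      by_contra hc
      rw [lam.part_eq_zero (not_lt.1 hc)] at hk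
      exact lt_irrefl _ hk
    rcases h3 with ⟨h3, h4⟩ | ⟨h3, h4⟩
    · have hm := key i (by omega)
      rcases lt_or_ge i' j' with h5 | h5
      · have := lam.add_part_anti hi hm
        omega
      · have := lam.add_part_anti (h5.trans hi) hm
        omega
    · have hm := key j (by omega)
      rcases lt_or_ge i' j' with h5 | h5
      · have := lam.add_part_anti (h5.le.trans hj) hm
        omega
      · have := lam.add_part_anti hj hm
        omega

theorem mem_double (lam : BarPartition) (i j : ℕ) : (i, j) ∈ lam.double ↔
    (i < j ∧ j ≤ i + lam.part i) ∨ (j ≤ i ∧ i < j + lam.part j) := by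
  rw [← YoungDiagram.mem_cells]
  simp only [double, Finset.mem_filter, Finset.mem_product, Finset.mem_range, and_iff_right_iff_imp]
  have key : ∀ k, 0 < lam.part k → k < lam.numParts ∧ k + lam.part k ≤ lam.part 0 + 0 :=
    fun k hk => by
      by_contra hc
      by_cases h : k < lam.numParts
      · have := lam.add_part_anti (Nat.zero_le k) h
        omega
      · rw [lam.part_eq_zero (not_lt.1 h)] at hk
        exact lt_irrefl _ hk
  rintro (⟨h1, h2⟩ | ⟨h1, h2⟩)
  · have := key i (by omega)
    omega
  · have := key j (by omega)
    omega

end BarPartition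

/-- The `β`-set with `n` elements of the partition with Young diagram `Y`
(for `n` at least the number of rows of `Y`). -/
def betaSet (Y : YoungDiagram) (n : ℕ) : Finset ℕ :=
  (Finset.range n).image fun i => Y.rowLen i + (n - 1 - i)

/-- The least multiple of `d` that is at least the number of rows of `Y`. -/
def normSize (d : ℕ) (Y : YoungDiagram) : ℕ := d * ((Y.colLen 0 + d - 1) / d)

/-- The `β`-set of the minimally normalized `d`-abacus of `Y`. -/
def normBetaSet (d : ℕ) (Y : YoungDiagram) : Finset ℕ := betaSet Y (normSize d Y)

/-- The positions of the beads of `X` on the `i`-th runner of the `d`-abacus. -/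
def runner (d : ℕ) (X : Finset ℕ) (i : ℕ) : Finset ℕ := (X.filter (· % d = i)).image (· / d)

/-- The multiset of (positive) parts of the partition with `β`-set `X`: each `x ∈ X` gives the part
equal to the number of non-elements of `X` below `x`, parts equal to `0` being dropped. -/
def betaPartition (X : Finset ℕ) : Multiset ℕ :=
  (X.val.map fun x => ((Finset.range x).filter (· ∉ X)).card).filter (0 < ·)

namespace BarPartition

/-- The `d̄`-quotient `(μ₀, μ₁, …, μ_{(d-1)/2})` of a bar partition. For `1 ≤ i ≤ (d-1)/2` the
partition `μᵢ` is the `i`-th component of the `d`-quotient of `D(λ)`, read off the normalized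
abacus; the bar partition `μ₀` (whose double is the `0`-th component) has as parts the parts of `λ`
divisible by `d`, divided by `d`. -/
def barQuotient (d : ℕ) (lam : BarPartition) :
    Finset ℕ × (Fin ((d - 1) / 2) → Multiset ℕ) :=
  ((lam.parts.filter (d ∣ ·)).image (· / d),
    fun i => betaPartition (runner d (normBetaSet d lam.double) (i + 1)))

/-- The empty bar partition. -/
def empty : BarPartition := ⟨∅, Finset.notMem_empty 0⟩

/-- `q` has empty `d̄`-core and the same `d̄`-quotient as `lam`. -/
def IsBarQuotientPartition (d : ℕ) (lam q : BarPartition) : Prop :=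
  IsBarCore d q empty ∧ barQuotient d q = barQuotient d lam

/-! ### Existence and uniqueness of the bar core -/

theorem RemovesBar.sum_lt {l : ℕ} {lam mu : BarPartition} (h : RemovesBar l lam mu) :
    ∑ a ∈ mu.parts, a < ∑ a ∈ lam.parts, a := by
  have pos : ∀ a ∈ lam.parts, 0 < a := fun a ha =>
    Nat.pos_of_ne_zero fun h0 => lam.zero_notMem (h0 ▸ ha)
  rcases h with ⟨a, ha, hl, hn, e⟩ | ⟨ha, e⟩ | ⟨a, ha, b, hb, hba, hl, e⟩
  · rw [e, Finset.sum_insert (by simp [hn]), ← Finset.add_sum_erase _ _ ha]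
    have : l ≠ 0 := by
      rintro rfl
      exact hn (by simpa using ha)
    omega
  · rw [e, ← Finset.add_sum_erase _ _ ha]
    have := pos l ha
    omega
  · have hb2 : b ∈ lam.parts.erase a := Finset.mem_erase.2 ⟨hba.ne, hb⟩
    rw [e, ← Finset.add_sum_erase _ _ ha, ← Finset.add_sum_erase _ _ hb2]
    have := pos a ha
    omega

theorem exists_isBarCore (d : ℕ) (lam : BarPartition) : ∃ c, IsBarCore d lam c := by
  induction hn : ∑ a ∈ lam.parts, a using Nat.strong_induction_on generalizing lam with
  | _ n ih =>
    by_cases h : ∀ l nu, d ∣ l → ¬ RemovesBar l lam nu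
    · exact ⟨lam, .refl, h⟩
    · push Not at h
      obtain ⟨l, nu, hd, hr⟩ := h
      obtain ⟨c, hc, ht⟩ := ih _ (hn ▸ hr.sum_lt) nu rfl
      exact ⟨c, .head ⟨l, hd, hr⟩ hc, ht⟩

/-- The number of parts congruent to `i` minus the number of parts congruent to `-i`. -/
def charge (d : ℕ) (lam : BarPartition) (i : ZMod d) : ℤ :=
  ∑ a ∈ lam.parts, ((if (a : ZMod d) = i then 1 else 0) - (if (a : ZMod d) = -i then 1 else 0))

theorem charge_neg (d : ℕ) (lam : BarPartition) (i : ZMod d) :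
    charge d lam (-i) = - charge d lam i := by
  simp only [charge, neg_neg, ← Finset.sum_neg_distrib, neg_sub]

theorem charge_zero (d : ℕ) (lam : BarPartition) : charge d lam 0 = 0 := by
  simp [charge]

theorem charge_eq_card (d : ℕ) (lam : BarPartition) (i : ZMod d) :
    charge d lam i = ((lam.parts.filter (fun a : ℕ => (a : ZMod d) = i)).card : ℤ) -
      ((lam.parts.filter (fun a : ℕ => (a : ZMod d) = -i)).card : ℤ) := by
  simp [charge, Finset.sum_sub_distrib]

theorem RemovesBar.charge_eq {d l : ℕ} {lam mu : BarPartition} (hd : d ∣ l)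
    (h : RemovesBar l lam mu) (i : ZMod d) : charge d mu i = charge d lam i := by
  have hl0 : (l : ZMod d) = 0 := (ZMod.natCast_eq_zero_iff l d).2 hd
  rcases h with ⟨a, ha, hl, hn, e⟩ | ⟨ha, e⟩ | ⟨a, ha, b, hb, hba, hl, e⟩
  · rw [charge, charge, e, Finset.sum_insert (by simp [hn]), ← Finset.add_sum_erase _ _ ha,
      Nat.cast_sub hl.le, hl0, sub_zero]
  · rw [charge, charge, e, ← Finset.add_sum_erase _ _ ha, hl0]
    simp [eq_comm]
  · have hb2 : b ∈ lam.parts.erase a := Finset.mem_erase.2 ⟨hba.ne, hb⟩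
    have hab : (b : ZMod d) = - (a : ZMod d) := by
      rw [← hl] at hl0
      push_cast at hl0
      linear_combination hl0
    rw [charge, charge, e, ← Finset.add_sum_erase _ _ ha, ← Finset.add_sum_erase _ _ hb2, hab]
    have h1 : (-(a : ZMod d) = i) ↔ ((a : ZMod d) = -i) := by
      constructor <;> intro h <;> linear_combination -h
    have h2 : (-(a : ZMod d) = -i) ↔ ((a : ZMod d) = i) := neg_inj
    simp only [h1, h2]
    ring

theorem IsBarCore.charge_eq {d : ℕ} {lam c : BarPartition} (h : IsBarCore d lam c) (i : ZMod d) :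
    charge d c i = charge d lam i := by
  obtain ⟨h, -⟩ := h
  induction h with
  | refl => rfl
  | tail _ h ih =>
    obtain ⟨l, hd, hr⟩ := h
    rw [hr.charge_eq hd, ih]

/-- A bar partition without bars of length divisible by `d` is determined by its charges. -/
theorem mem_of_no_bar {d : ℕ} (hd : Odd d) {c : BarPartition}
    (hc : ∀ l nu, d ∣ l → ¬ RemovesBar l c nu) {a : ℕ} (ha : 0 < a) :
    a ∈ c.parts ↔ ((a / d : ℕ) : ℤ) < charge d c a := by
  have hd0 : 0 < d := hd.pos
  have noDvd : ∀ x ∈ c.parts, ¬ d ∣ x := fun x hx hdx =>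
    hc x ⟨c.parts.erase x, fun h => c.zero_notMem (Finset.mem_of_mem_erase h)⟩ hdx
      (Or.inr (Or.inl ⟨hx, rfl⟩))
  have lower : ∀ x ∈ c.parts, ∀ y, 0 < y → y < x → d ∣ x - y → y ∈ c.parts := by
    intro x hx y hy hyx hdv
    by_contra hyc
    have e : x - (x - y) = y := by omega
    refine hc (x - y) ⟨insert y (c.parts.erase x), ?_⟩ hdv
      (Or.inl ⟨x, hx, by omega, by rwa [e], by simp [e]⟩)
    simp only [Finset.mem_insert, Finset.mem_erase, not_or, not_and]
    exact ⟨hy.ne, fun _ => c.zero_notMem⟩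
  have noPair : ∀ x ∈ c.parts, ∀ y ∈ c.parts, y < x → ¬ d ∣ x + y := by
    intro x hx y hy hyx hdv
    exact hc (x + y) ⟨(c.parts.erase x).erase y,
      fun h => c.zero_notMem (Finset.mem_of_mem_erase (Finset.mem_of_mem_erase h))⟩ hdv
      (Or.inr (Or.inr ⟨x, hx, y, hy, hyx, rfl, rfl⟩))
  by_cases hda : d ∣ a
  · have h0 : (a : ZMod d) = 0 := (ZMod.natCast_eq_zero_iff a d).2 hda
    rw [h0, charge_zero]
    exact ⟨fun h => absurd hda (noDvd a h), fun h => absurd h (not_lt.2 (Int.natCast_nonneg _))⟩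
  have key : ∀ x : ℕ, (x : ZMod d) = a ↔ x % d = a % d := fun x =>
    ZMod.natCast_eq_natCast_iff' x a d
  rw [charge_eq_card]
  simp only [key]
  constructor
  · intro hac
    have hT : (c.parts.filter (fun x : ℕ => (x : ZMod d) = -(a : ZMod d))) = ∅ := by
      rw [Finset.filter_eq_empty_iff]
      intro b hb hba
      have hs : d ∣ a + b := by
        rw [← ZMod.natCast_eq_zero_iff]
        push_cast
        rw [hba]
        ring
      rcases lt_trichotomy b a with h | h | h
      · exact noPair a hac b hb h hs
      · subst h
        have h2 : d ∣ 2 * b := by rwa [two_mul]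
        exact hda (Nat.Coprime.dvd_of_dvd_mul_left hd.coprime_two_right h2)
      · exact noPair b hb a hac h (by rwa [add_comm])
    rw [hT, Finset.card_empty]
    have hsub : (Finset.range (a / d + 1)).image (fun k => a % d + d * k) ⊆
        c.parts.filter (fun x => x % d = a % d) := by
      intro x hx
      simp only [Finset.mem_image, Finset.mem_range] at hx
      obtain ⟨k, hk, rfl⟩ := hx
      simp only [Finset.mem_filter, Nat.add_mul_mod_self_left, Nat.mod_mod, and_true]
      have hm := Nat.mod_add_div a d
      have h1 : 0 < a % d := Nat.pos_of_ne_zero fun h => hda (Nat.dvd_of_mod_eq_zero h)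
      have h2 : d * k ≤ d * (a / d) := Nat.mul_le_mul_left _ (by omega)
      rcases (show a % d + d * k ≤ a by omega).eq_or_lt with h | h
      · rwa [h]
      · refine lower a hac _ (by omega) h ?_
        rw [show a - (a % d + d * k) = d * (a / d) - d * k by omega]
        exact Nat.dvd_sub (Dvd.intro _ rfl) (Dvd.intro _ rfl)
    have hcard := Finset.card_le_card hsub
    rw [Finset.card_image_of_injective _ (fun x y h => by
      have : d * x = d * y := by simpa using h
      exact Nat.eq_of_mul_eq_mul_left hd0 this), Finset.card_range] at hcard
    push_cast
    omega
  · intro h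
    by_contra hac
    have hlt : ∀ x ∈ c.parts.filter (fun x => x % d = a % d), x < a := by
      intro x hx
      rw [Finset.mem_filter] at hx
      by_contra hxa
      have hne : x ≠ a := by
        rintro rfl
        exact hac hx.1
      exact hac (lower x hx.1 a ha (by omega)
        ((Nat.modEq_iff_dvd' (by omega)).1 hx.2.symm))
    have hcard : (c.parts.filter (fun x => x % d = a % d)).card ≤ (Finset.range (a / d)).card := by
      refine Finset.card_le_card_of_injOn (· / d) ?_ ?_
      · intro x hx
        have h1 := hlt x hx
        have h2 := (Finset.mem_filter.1 hx).2
        have h3 := Nat.mod_add_div x d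
        have h4 := Nat.mod_add_div a d
        simp only [Finset.coe_range, Set.mem_Iio]
        have : d * (x / d) < d * (a / d) := by omega
        exact Nat.lt_of_mul_lt_mul_left this
      · intro x hx y hy hxy
        have h1 := (Finset.mem_filter.1 hx).2
        have h2 := (Finset.mem_filter.1 hy).2
        have h3 := Nat.mod_add_div x d
        have h4 := Nat.mod_add_div y d
        simp only at hxy
        rw [← hxy] at h4
        omega
    rw [Finset.card_range] at hcard
    omega

theorem ext_of_pos {lam mu : BarPartition}
    (h : ∀ a, 0 < a → (a ∈ lam.parts ↔ a ∈ mu.parts)) : lam = mu := by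
  ext a
  rcases Nat.eq_zero_or_pos a with rfl | ha
  · exact iff_of_false lam.zero_notMem mu.zero_notMem
  · exact h a ha

theorem existsUnique_isBarCore {d : ℕ} (hd : Odd d) (lam : BarPartition) :
    ∃! c, IsBarCore d lam c := by
  obtain ⟨c, hc⟩ := exists_isBarCore d lam
  refine ⟨c, hc, fun e he => ext_of_pos fun a ha => ?_⟩
  rw [mem_of_no_bar hd he.2 ha, mem_of_no_bar hd hc.2 ha, he.charge_eq, hc.charge_eq]

theorem isBarCore_empty_iff {d : ℕ} (hd : Odd d) (lam : BarPartition) :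
    IsBarCore d lam empty ↔ ∀ i, charge d lam i = 0 := by
  constructor
  · intro h i
    rw [← h.charge_eq]
    simp [charge, empty]
  · intro h
    obtain ⟨c, hc⟩ := exists_isBarCore d lam
    have : c = empty := ext_of_pos fun a ha => by
      rw [mem_of_no_bar hd hc.2 ha, hc.charge_eq, h]
      simp only [empty, Finset.notMem_empty, iff_false, not_lt]
      positivity
    exact this ▸ hc

end BarPartition

/-! ### Existence and uniqueness of the bar quotient partition -/

/-- The number of non-elements of `X` below `x`. -/
def gapsBelow (X : Finset ℕ) (x : ℕ) : ℕ := ((Finset.range x).filter (· ∉ X)).card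

theorem betaPartition_shift (X : Finset ℕ) :
    betaPartition (insert 0 (X.map (addRightEmbedding 1))) = betaPartition X := by
  have h0 : 0 ∉ X.map (addRightEmbedding 1) := by simp
  have hg : ∀ x, gapsBelow (insert 0 (X.map (addRightEmbedding 1))) (x + 1) = gapsBelow X x := by
    intro x
    unfold gapsBelow
    rw [← Finset.card_map (addRightEmbedding 1) (s := (Finset.range x).filter (· ∉ X))]
    congr 1
    ext g
    rcases g with _ | g
    · simp
    · simp
  change Multiset.filter _ (Multiset.map (gapsBelow _) _) =
    Multiset.filter _ (Multiset.map (gapsBelow X) _)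
  rw [Finset.insert_val_of_notMem h0, Multiset.map_cons, Finset.map_val, Multiset.map_map,
    Multiset.filter_cons_of_neg _ (by simp [gapsBelow])]
  congr 1
  exact Multiset.map_congr rfl fun x _ => hg x

theorem gapsBelow_mono (X : Finset ℕ) : Monotone (gapsBelow X) := fun _ _ h =>
  Finset.card_le_card (Finset.filter_subset_filter _ (Finset.range_mono h))

theorem gapsBelow_max {X : Finset ℕ} {x : ℕ} (hx : x ∈ X) (h : ∀ y ∈ X, y ≤ x) :
    gapsBelow X x + X.card = x + 1 := by
  have h1 : (Finset.range (x + 1)).filter (· ∈ X) = X := by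
    ext y
    simp only [Finset.mem_filter, Finset.mem_range, and_iff_right_iff_imp]
    intro hy
    have := h y hy
    omega
  have h2 := Finset.card_filter_add_card_filter_not (s := Finset.range (x + 1)) (· ∈ X)
  rw [h1, Finset.card_range, Finset.range_add_one, Finset.filter_insert, if_neg (by simpa)] at h2
  unfold gapsBelow
  omega

theorem eq_of_map_gapsBelow (X Y : Finset ℕ)
    (h : X.val.map (gapsBelow X) = Y.val.map (gapsBelow Y)) : X = Y := by
  induction hn : X.card generalizing X Y with
  | zero =>
    have hX := Finset.card_eq_zero.1 hn
    subst hX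
    have h2 := congrArg Multiset.card h
    simp only [Multiset.card_map, Finset.card_val, Finset.card_empty] at h2
    exact (Finset.card_eq_zero.1 h2.symm).symm
  | succ n ih =>
    have hc : Y.card = X.card := by
      have := congrArg Multiset.card h
      simpa using this.symm
    have hX : X.Nonempty := Finset.card_pos.1 (by omega)
    have hY : Y.Nonempty := Finset.card_pos.1 (by omega)
    have le : ∀ U V : Finset ℕ, ∀ hU : U.Nonempty, ∀ hV : V.Nonempty,
        U.val.map (gapsBelow U) = V.val.map (gapsBelow V) →
        gapsBelow U (U.max' hU) ≤ gapsBelow V (V.max' hV) := by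
      intro U V hU hV h
      have : gapsBelow U (U.max' hU) ∈ V.val.map (gapsBelow V) :=
        h ▸ Multiset.mem_map_of_mem _ (U.max'_mem hU)
      obtain ⟨v, hv, hv2⟩ := Multiset.mem_map.1 this
      rw [← hv2]
      exact gapsBelow_mono V (V.le_max' v hv)
    have hg := le_antisymm (le X Y hX hY h) (le Y X hY hX h.symm)
    have e1 := gapsBelow_max (X.max'_mem hX) (X.le_max')
    have e2 := gapsBelow_max (Y.max'_mem hY) (Y.le_max')
    have hm : X.max' hX = Y.max' hY := by omega
    have er : ∀ U : Finset ℕ, ∀ hU : U.Nonempty,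
        (U.erase (U.max' hU)).val.map (gapsBelow (U.erase (U.max' hU))) =
          (U.val.map (gapsBelow U)).erase (gapsBelow U (U.max' hU)) := by
      intro U hU
      have h1 : (U.erase (U.max' hU)).val.map (gapsBelow (U.erase (U.max' hU))) =
          (U.erase (U.max' hU)).val.map (gapsBelow U) := by
        refine Multiset.map_congr rfl fun x hx => ?_
        have hx1 : x < U.max' hU := U.lt_max'_of_mem_erase_max' hU hx
        unfold gapsBelow
        congr 1
        refine Finset.filter_congr fun y hy => ?_
        have : y ≠ U.max' hU := by
          rw [Finset.mem_range] at hy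
          omega
        simp [this]
      rw [h1, Finset.erase_val, Multiset.map_erase_of_mem _ _ (U.max'_mem hU)]
    have he := ih (X.erase (X.max' hX)) (Y.erase (Y.max' hY))
      (by rw [er X hX, er Y hY, h, hg])
      (by rw [Finset.card_erase_of_mem (X.max'_mem hX), hn]; rfl)
    rw [← Finset.insert_erase (X.max'_mem hX), ← Finset.insert_erase (Y.max'_mem hY), he, hm]

theorem eq_of_betaPartition {X Y : Finset ℕ} (hc : X.card = Y.card)
    (h : betaPartition X = betaPartition Y) : X = Y := by
  apply eq_of_map_gapsBelow
  have h' : (X.val.map (gapsBelow X)).filter (0 < ·) = (Y.val.map (gapsBelow Y)).filter (0 < ·) := h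
  have hz : ∀ s : Multiset ℕ, s.filter (fun x => ¬ 0 < x) =
      Multiset.replicate (Multiset.card s - Multiset.card (s.filter (0 < ·))) 0 := by
    intro s
    rw [Multiset.eq_replicate]
    constructor
    · have := congrArg Multiset.card (Multiset.filter_add_not (0 < ·) s)
      rw [Multiset.card_add] at this
      omega
    · intro b hb
      have := (Multiset.mem_filter.1 hb).2
      omega
  rw [← Multiset.filter_add_not (0 < ·) (X.val.map (gapsBelow X)),
    ← Multiset.filter_add_not (0 < ·) (Y.val.map (gapsBelow Y)), hz, hz, h']
  simp [hc]

namespace BarPartition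

/-- The beads of the doubled partition on the abacus infinite in both directions. -/
def Bead (lam : BarPartition) (z : ℤ) : Prop :=
  (0 < z ∧ z.toNat ∈ lam.parts) ∨ (z < 0 ∧ (-z).toNat ∉ lam.parts)

theorem bead_natCast (lam : BarPartition) {a : ℕ} (ha : 0 < a) :
    lam.Bead a ↔ a ∈ lam.parts := by
  unfold Bead
  have h1 : (0 : ℤ) < a := by exact_mod_cast ha
  simp [not_lt.2 h1.le, ha]

theorem bead_neg (lam : BarPartition) {z : ℤ} (hz : z ≠ 0) :
    lam.Bead (-z) ↔ ¬ lam.Bead z := by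
  unfold Bead
  rcases lt_or_gt_of_ne hz with h | h
  · have h1 : ¬ 0 < z := by omega
    have h2 : 0 < -z := by omega
    have h3 : ¬ -z < 0 := by omega
    simp only [h, h1, h2, h3, true_and, false_and, false_or, or_false, not_not]
  · have h1 : ¬ z < 0 := by omega
    have h2 : -z < 0 := by omega
    have h3 : ¬ 0 < -z := by omega
    simp only [h, h1, h2, h3, true_and, false_and, false_or, or_false, neg_neg]

theorem le_part_zero (lam : BarPartition) {a : ℕ} (h : a ∈ lam.parts) : a ≤ lam.part 0 := by
  obtain ⟨i, hi, rfl⟩ := lam.exists_part h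
  rcases Nat.eq_zero_or_pos i with rfl | h0
  · exact le_rfl
  · exact (lam.part_lt h0 hi).le

theorem colLen_double_zero (lam : BarPartition) : lam.double.colLen 0 = lam.part 0 := by
  refine eq_of_forall_lt_iff fun i => ?_
  rw [← YoungDiagram.mem_iff_lt_colLen, mem_double]
  omega

theorem rowLen_double_of_lt (lam : BarPartition) {i : ℕ} (hi : i < lam.numParts) :
    lam.double.rowLen i = i + 1 + lam.part i := by
  refine eq_of_forall_lt_iff fun j => ?_
  rw [← YoungDiagram.mem_iff_lt_rowLen, mem_double]
  have := lam.part_pos hi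
  constructor
  · omega
  · intro h
    rcases lt_or_ge i j with h1 | h1
    · omega
    · have := lam.add_part_anti h1 hi
      omega

theorem lt_rowLen_double_of_ge (lam : BarPartition) {i j : ℕ} (hi : lam.numParts ≤ i) :
    j < lam.double.rowLen i ↔ j < lam.numParts ∧ i < j + lam.part j := by
  rw [← YoungDiagram.mem_iff_lt_rowLen, mem_double, lam.part_eq_zero hi]
  constructor
  · intro h
    have h2 : j ≤ i ∧ i < j + lam.part j := by omega
    refine ⟨?_, h2.2⟩
    by_contra hc
    rw [lam.part_eq_zero (not_lt.1 hc)] at h2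
    omega
  · intro h
    omega

theorem mem_betaSet_double (lam : BarPartition) {N : ℕ} (hN : lam.part 0 ≤ N) (x : ℕ) :
    x ∈ betaSet lam.double N ↔ lam.Bead ((x : ℤ) - N) := by
  have hsub : lam.parts ⊆ Finset.Icc 1 N := fun a ha => by
    have h1 : a ≠ 0 := fun h0 => lam.zero_notMem (h0 ▸ ha)
    have := lam.le_part_zero ha
    simp only [Finset.mem_Icc]
    omega
  have hmN : lam.numParts ≤ N := by
    have := Finset.card_le_card hsub
    simpa [numParts] using this
  have hT : betaSet lam.double N =
      lam.parts.image (N + ·) ∪ (Finset.Icc 1 N \ lam.parts).image (N - ·) := by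
    refine Finset.eq_of_subset_of_card_le ?_ ?_
    · intro x hx
      simp only [betaSet, Finset.mem_image, Finset.mem_range] at hx
      obtain ⟨i, hi, rfl⟩ := hx
      rw [Finset.mem_union, Finset.mem_image, Finset.mem_image]
      rcases lt_or_ge i lam.numParts with him | him
      · left
        refine ⟨lam.part i, lam.part_mem him, ?_⟩
        rw [lam.rowLen_double_of_lt him]
        omega
      · right
        have hr := fun j => lam.lt_rowLen_double_of_ge (i := i) (j := j) him
        have hrm : lam.double.rowLen i ≤ lam.numParts := by
          by_contra hc
          have := (hr _).1 (not_le.1 hc)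
          omega
        refine ⟨i + 1 - lam.double.rowLen i, ?_, by omega⟩
        simp only [Finset.mem_sdiff, Finset.mem_Icc]
        refine ⟨by omega, fun hmem => ?_⟩
        obtain ⟨t, ht, hte⟩ := lam.exists_part hmem
        rcases lt_or_ge t (lam.double.rowLen i) with h | h
        · have h1 := (hr (lam.double.rowLen i - 1)).1 (by omega)
          have h2 : lam.part (lam.double.rowLen i - 1) ≤ lam.part t := by
            rcases (show t ≤ lam.double.rowLen i - 1 by omega).eq_or_lt with h3 | h3
            · rw [← h3]
            · exact (lam.part_lt h3 h1.1).le
          omega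
        · have h1 : ¬ (lam.double.rowLen i < lam.double.rowLen i) := lt_irrefl _
          rw [hr] at h1
          have h2 : lam.part t ≤ lam.part (lam.double.rowLen i) := by
            rcases h.eq_or_lt with h3 | h3
            · rw [← h3]
            · exact (lam.part_lt h3 ht).le
          have h3 : lam.double.rowLen i < lam.numParts := by omega
          omega
    · have h1 : (betaSet lam.double N).card = N := by
        rw [betaSet, Finset.card_image_of_injOn, Finset.card_range]
        intro i hi j hj hij
        simp only [Finset.coe_range, Set.mem_Iio] at hi hj hij
        rcases lt_trichotomy i j with h | h | h
        · have := lam.double.rowLen_anti i j h.le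
          omega
        · exact h
        · have := lam.double.rowLen_anti j i h.le
          omega
      have h2 := Finset.card_union_le (lam.parts.image (N + ·))
        ((Finset.Icc 1 N \ lam.parts).image (N - ·))
      have h3 := Finset.card_image_le (s := lam.parts) (f := (N + ·))
      have h4 := Finset.card_image_le (s := Finset.Icc 1 N \ lam.parts) (f := (N - ·))
      rw [Finset.card_sdiff_of_subset hsub, Nat.card_Icc] at h4
      have h5 := Finset.card_le_card hsub
      rw [Nat.card_Icc] at h5
      omega
  rw [hT, Finset.mem_union, Finset.mem_image, Finset.mem_image]
  unfold Bead
  constructor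
  · rintro (⟨a, ha, rfl⟩ | ⟨a, ha, rfl⟩)
    · have h1 : a ≠ 0 := fun h0 => lam.zero_notMem (h0 ▸ ha)
      left
      refine ⟨by omega, ?_⟩
      rwa [show (((N + a : ℕ) : ℤ) - N).toNat = a by omega]
    · simp only [Finset.mem_sdiff, Finset.mem_Icc] at ha
      right
      refine ⟨by omega, ?_⟩
      rw [show (-(((N - a : ℕ) : ℤ) - N)).toNat = a by omega]
      exact ha.2
  · rintro (⟨h, ha⟩ | ⟨h, ha⟩)
    · exact Or.inl ⟨_, ha, by omega⟩
    · refine Or.inr ⟨(-((x : ℤ) - N)).toNat, ?_, by omega⟩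
      simp only [Finset.mem_sdiff, Finset.mem_Icc]
      exact ⟨by omega, ha⟩

theorem mem_runner_double (lam : BarPartition) {d n i : ℕ} (hi : i < d)
    (hn : lam.part 0 ≤ d * n) (k : ℕ) :
    k ∈ runner d (betaSet lam.double (d * n)) i ↔ lam.Bead (d * ((k : ℤ) - n) + i) := by
  have h1 : k ∈ runner d (betaSet lam.double (d * n)) i ↔
      d * k + i ∈ betaSet lam.double (d * n) := by
    simp only [runner, Finset.mem_image, Finset.mem_filter]
    constructor
    · rintro ⟨x, ⟨hx, h1⟩, h2⟩
      rwa [← h1, ← h2, Nat.div_add_mod]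
    · intro h
      refine ⟨_, ⟨h, ?_⟩, ?_⟩
      · rw [Nat.mul_add_mod, Nat.mod_eq_of_lt hi]
      · rw [Nat.mul_add_div (by omega), Nat.div_eq_of_lt hi, add_zero]
  rw [h1, mem_betaSet_double lam hn]
  push_cast
  ring_nf

theorem betaPartition_runner (lam : BarPartition) {d i m n : ℕ} (hi : i < d) (hmn : m ≤ n)
    (hm : lam.part 0 ≤ d * m) :
    betaPartition (runner d (betaSet lam.double (d * n)) i) =
      betaPartition (runner d (betaSet lam.double (d * m)) i) := by
  induction n, hmn using Nat.le_induction with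
  | base => rfl
  | succ n hn ih =>
    have hn1 : lam.part 0 ≤ d * n := hm.trans (Nat.mul_le_mul_left d hn)
    rw [← ih, ← betaPartition_shift (runner d (betaSet lam.double (d * n)) i)]
    congr 1
    ext k
    rw [mem_runner_double lam hi (hn1.trans (Nat.mul_le_mul_left d (Nat.le_succ n))),
      Finset.mem_insert, Finset.mem_map]
    rcases k with _ | k
    · simp only [true_or, iff_true]
      right
      have h1 : ((d * n : ℕ) : ℤ) = (d : ℤ) * n := by push_cast; ring
      have h2 : (d : ℤ) * (((0 : ℕ) : ℤ) - ((n + 1 : ℕ) : ℤ)) + i = -(d * n : ℕ) - d + i := by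
        push_cast
        ring
      rw [h2]
      refine ⟨by omega, fun hmem => ?_⟩
      have := lam.le_part_zero hmem
      omega
    · have h1 : (d : ℤ) * (((k + 1 : ℕ) : ℤ) - ((n + 1 : ℕ) : ℤ)) + i =
          d * ((k : ℤ) - n) + i := by
        push_cast
        ring
      rw [h1, ← mem_runner_double lam hi hn1]
      simp

theorem barQuotient_snd (lam : BarPartition) {d : ℕ} (hd : 0 < d) {n : ℕ}
    (hn : lam.part 0 ≤ n) (i : Fin ((d - 1) / 2)) :
    (barQuotient d lam).2 i = betaPartition (runner d (betaSet lam.double (d * n)) (i + 1)) := by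
  have hi : (i : ℕ) + 1 < d := by
    have := i.2
    omega
  have h0 : lam.part 0 ≤ d * ((lam.part 0 + d - 1) / d) := by
    have h1 := Nat.div_add_mod (lam.part 0 + d - 1) d
    have h2 := Nat.mod_lt (lam.part 0 + d - 1) hd
    omega
  have h1 : lam.part 0 ≤ d * n := hn.trans (Nat.le_mul_of_pos_left n hd)
  simp only [barQuotient, normBetaSet, normSize, colLen_double_zero]
  rcases le_total n ((lam.part 0 + d - 1) / d) with h | h
  · exact betaPartition_runner lam hi h h1
  · exact (betaPartition_runner lam hi h h0).symm

theorem card_runner (lam : BarPartition) {d n i : ℕ} (hi0 : 0 < i) (hi : i < d)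
    (hn : lam.part 0 ≤ n) :
    ((runner d (betaSet lam.double (d * n)) i).card : ℤ) = n + charge d lam (i : ZMod d) := by
  have hd : 0 < d := by omega
  have hn1 : lam.part 0 ≤ d * n := hn.trans (Nat.le_mul_of_pos_left n hd)
  have hmem := lam.mem_runner_double hi hn1
  set Y := runner d (betaSet lam.double (d * n)) i
  have key : ∀ x : ℕ, (x : ZMod d) = i ↔ x % d = i := fun x => by
    rw [ZMod.natCast_eq_natCast_iff', Nat.mod_eq_of_lt hi]
  have key2 : ∀ x : ℕ, (x : ZMod d) = -i ↔ d ∣ x + i := fun x => by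
    rw [← ZMod.natCast_eq_zero_iff, Nat.cast_add, eq_neg_iff_add_eq_zero]
  have c1 : (Y.filter (n ≤ ·)).card =
      (lam.parts.filter (fun a : ℕ => (a : ZMod d) = (i : ZMod d))).card := by
    refine Finset.card_nbij' (fun k => d * (k - n) + i) (fun a => n + a / d) ?_ ?_ ?_ ?_
    · intro k hk
      obtain ⟨h1, h2⟩ := Finset.mem_filter.1 hk
      rw [hmem] at h1
      have e : (d : ℤ) * ((k : ℤ) - n) + i = ((d * (k - n) + i : ℕ) : ℤ) := by
        push_cast [h2]
        ring
      rw [e, bead_natCast lam (by omega)] at h1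
      refine Finset.mem_coe.2 (Finset.mem_filter.2 ⟨h1, ?_⟩)
      rw [key, Nat.mul_add_mod, Nat.mod_eq_of_lt hi]
    · intro a ha
      obtain ⟨h1, h2⟩ := Finset.mem_filter.1 ha
      rw [key] at h2
      have h3 := Nat.div_add_mod a d
      refine Finset.mem_coe.2 (Finset.mem_filter.2 ⟨?_, Nat.le_add_right _ _⟩)
      rw [hmem]
      have e : (d : ℤ) * (((n + a / d : ℕ) : ℤ) - n) + i = (a : ℤ) := by
        conv_rhs => rw [← h3, h2]
        push_cast
        ring
      rw [e, bead_natCast lam (by omega)]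
      exact h1
    · intro k hk
      obtain ⟨h1, h2⟩ := Finset.mem_filter.1 hk
      simp only
      rw [Nat.mul_add_div hd, Nat.div_eq_of_lt hi]
      omega
    · intro a ha
      obtain ⟨h1, h2⟩ := Finset.mem_filter.1 ha
      rw [key] at h2
      have h3 := Nat.div_add_mod a d
      simp only [Nat.add_sub_cancel_left]
      omega
  have c2 : ((Finset.range n).filter (· ∉ Y)).card =
      (lam.parts.filter (fun a : ℕ => (a : ZMod d) = -(i : ZMod d))).card := by
    refine Finset.card_nbij' (fun k => d * (n - k) - i) (fun a => n - (a + i) / d) ?_ ?_ ?_ ?_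
    · intro k hk
      obtain ⟨h1, h2⟩ := Finset.mem_filter.1 hk
      rw [Finset.mem_range] at h1
      have h3 : d * 1 ≤ d * (n - k) := Nat.mul_le_mul_left d (by omega)
      have e : (d : ℤ) * ((k : ℤ) - n) + i = -((d * (n - k) - i : ℕ) : ℤ) := by
        rw [Nat.cast_sub (by omega), Nat.cast_mul, Nat.cast_sub h1.le]
        ring
      rw [hmem, e, bead_neg lam (by omega), not_not, bead_natCast lam (by omega)] at h2
      refine Finset.mem_coe.2 (Finset.mem_filter.2 ⟨h2, ?_⟩)
      rw [key2, Nat.sub_add_cancel (by omega)]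
      exact Dvd.intro _ rfl
    · intro a ha
      obtain ⟨h1, h2⟩ := Finset.mem_filter.1 ha
      rw [key2] at h2
      obtain ⟨t, ht⟩ := h2
      have ha0 : a ≠ 0 := fun h0 => lam.zero_notMem (h0 ▸ h1)
      have hle := lam.le_part_zero h1
      have ht0 : 0 < t := Nat.pos_of_ne_zero fun h => by
        rw [h, mul_zero] at ht
        omega
      have htn : t ≤ n := by
        by_contra hc
        have : d * (n + 1) ≤ d * t := Nat.mul_le_mul_left d (by omega)
        rw [mul_add, mul_one] at this
        omega
      refine Finset.mem_coe.2 (Finset.mem_filter.2 ⟨?_, ?_⟩)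
      · simp only
        rw [ht, Nat.mul_div_cancel_left t hd, Finset.mem_range]
        omega
      · rw [hmem]
        have e : (d : ℤ) * (((n - (a + i) / d : ℕ) : ℤ) - n) + i = -(a : ℤ) := by
          rw [ht, Nat.mul_div_cancel_left t hd, Nat.cast_sub htn]
          have : (a : ℤ) + i = d * t := by exact_mod_cast ht
          linear_combination this
        rw [e, bead_neg lam (by omega), not_not, bead_natCast lam (by omega)]
        exact h1
    · intro k hk
      obtain ⟨h1, h2⟩ := Finset.mem_filter.1 hk
      rw [Finset.mem_range] at h1
      have h3 : d * 1 ≤ d * (n - k) := Nat.mul_le_mul_left d (by omega)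
      simp only
      rw [Nat.sub_add_cancel (by omega), Nat.mul_div_cancel_left _ hd]
      omega
    · intro a ha
      obtain ⟨h1, h2⟩ := Finset.mem_filter.1 ha
      rw [key2] at h2
      obtain ⟨t, ht⟩ := h2
      have hle := lam.le_part_zero h1
      have htn : t ≤ n := by
        by_contra hc
        have : d * (n + 1) ≤ d * t := Nat.mul_le_mul_left d (by omega)
        rw [mul_add, mul_one] at this
        omega
      simp only
      rw [ht, Nat.mul_div_cancel_left t hd, Nat.sub_sub_self htn]
      omega
  have s1 := Finset.card_filter_add_card_filter_not (s := Y) (n ≤ ·)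
  have s2 := Finset.card_filter_add_card_filter_not (s := Finset.range n) (· ∈ Y)
  have s3 : Y.filter (fun k => ¬ n ≤ k) = (Finset.range n).filter (· ∈ Y) := by
    ext k
    simp [and_comm]
  rw [s3] at s1
  rw [Finset.card_range] at s2
  rw [charge_eq_card]
  omega

/-- Beads of `q` are beads of `lam`, moved along their runners to charge `0`. -/
theorem runner_eq_of_bead {d : ℕ} {lam q : BarPartition}
    (h : ∀ z : ℤ, q.Bead z ↔ lam.Bead (z + d * charge d lam (z : ZMod d)))
    {i n n' : ℕ} (hi : i < d) (hn : q.part 0 ≤ d * n) (hn' : lam.part 0 ≤ d * n')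
    (hc : (n : ℤ) = n' + charge d lam (i : ZMod d)) :
    runner d (betaSet q.double (d * n)) i = runner d (betaSet lam.double (d * n')) i := by
  ext k
  rw [mem_runner_double q hi hn, mem_runner_double lam hi hn', h]
  have e : (((d : ℤ) * ((k : ℤ) - n) + i : ℤ) : ZMod d) = (i : ZMod d) := by
    push_cast
    simp
  rw [e, hc]
  ring_nf

theorem abs_charge_le (d : ℕ) (lam : BarPartition) (i : ZMod d) :
    |charge d lam i| ≤ lam.numParts := by
  rw [charge_eq_card]
  have h1 := Finset.card_filter_le lam.parts (fun a : ℕ => (a : ZMod d) = i)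
  have h2 := Finset.card_filter_le lam.parts (fun a : ℕ => (a : ZMod d) = -i)
  rw [abs_le]
  unfold numParts
  omega

theorem exists_bead (d : ℕ) (lam : BarPartition) : ∃ q : BarPartition,
    ∀ z : ℤ, q.Bead z ↔ lam.Bead (z + d * charge d lam (z : ZMod d)) := by
  classical
  let q : BarPartition := ⟨(Finset.Icc 1 (lam.part 0 + d * lam.numParts)).filter
    (fun a : ℕ => lam.Bead (a + d * charge d lam (a : ZMod d))), by simp⟩
  have hpos : ∀ a : ℕ, 0 < a →
      (q.Bead a ↔ lam.Bead (a + d * charge d lam (a : ZMod d))) := by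
    intro a ha
    rw [bead_natCast q ha]
    simp only [q, Finset.mem_filter, Finset.mem_Icc, and_iff_right_iff_imp]
    intro hb
    refine ⟨ha, ?_⟩
    have h1 := abs_charge_le d lam (a : ZMod d)
    have h2 : -((d : ℤ) * lam.numParts) ≤ d * charge d lam (a : ZMod d) := by
      rw [← mul_neg]
      exact mul_le_mul_of_nonneg_left (abs_le.1 h1).1 (Int.natCast_nonneg d)
    have h3 : ((d * lam.numParts : ℕ) : ℤ) = (d : ℤ) * lam.numParts := by push_cast; ring
    by_contra hc
    rcases hb with ⟨h4, h5⟩ | ⟨h4, h5⟩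
    · have := lam.le_part_zero h5
      omega
    · omega
  refine ⟨q, fun z => ?_⟩
  rcases lt_trichotomy z 0 with hz | hz | hz
  · obtain ⟨a, rfl⟩ : ∃ a : ℕ, z = -(a : ℤ) := ⟨(-z).toNat, by omega⟩
    have ha : 0 < a := by omega
    have e : -(a : ℤ) + d * charge d lam ((-(a : ℤ) : ℤ) : ZMod d) =
        -((a : ℤ) + d * charge d lam (a : ZMod d)) := by
      push_cast
      rw [charge_neg]
      ring
    have hne : (a : ℤ) + d * charge d lam (a : ZMod d) ≠ 0 := by
      intro h0
      have hdv : (d : ℤ) ∣ a := ⟨-charge d lam (a : ZMod d), by linear_combination h0⟩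
      have : (a : ZMod d) = 0 := (ZMod.natCast_eq_zero_iff a d).2 (by exact_mod_cast hdv)
      rw [this, charge_zero] at h0
      omega
    rw [e, bead_neg q (by omega), bead_neg lam hne, hpos a ha]
  · subst hz
    simp [Bead, charge_zero]
  · obtain ⟨a, rfl⟩ : ∃ a : ℕ, z = (a : ℤ) := ⟨z.toNat, by omega⟩
    rw [hpos a (by omega)]
    simp

theorem exists_isBarQuotientPartition {d : ℕ} (hd : Odd d) (lam : BarPartition) :
    ∃ q, IsBarQuotientPartition d lam q := by
  obtain ⟨q, hq⟩ := exists_bead d lam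
  have hd0 : 0 < d := hd.pos
  have : NeZero d := ⟨hd0.ne'⟩
  have run : ∀ i < d, ∃ n n' : ℕ, q.part 0 ≤ n ∧ lam.part 0 ≤ n' ∧
      (n : ℤ) = n' + charge d lam (i : ZMod d) ∧
      runner d (betaSet q.double (d * n)) i = runner d (betaSet lam.double (d * n')) i := by
    intro i hi
    have h1 := abs_le.1 (abs_charge_le d lam (i : ZMod d))
    refine ⟨(q.part 0 + lam.part 0 + lam.numParts + charge d lam (i : ZMod d)).toNat,
      q.part 0 + lam.part 0 + lam.numParts, by omega, by omega, by omega, ?_⟩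
    exact runner_eq_of_bead hq hi
      (le_trans (by omega) (Nat.le_mul_of_pos_left _ hd0))
      (le_trans (by omega) (Nat.le_mul_of_pos_left _ hd0)) (by omega)
  refine ⟨q, (isBarCore_empty_iff hd q).2 fun i => ?_, ?_⟩
  · by_cases hi0 : i = 0
    · rw [hi0, charge_zero]
    obtain ⟨n, n', h1, h2, h3, h4⟩ := run i.val i.val_lt
    have hv : 0 < i.val := Nat.pos_of_ne_zero fun h => hi0 ((ZMod.val_eq_zero i).1 h)
    have e1 := card_runner q hv i.val_lt h1
    have e2 := card_runner lam hv i.val_lt h2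
    rw [ZMod.natCast_zmod_val] at e1 e2 h3
    rw [h4] at e1
    omega
  · refine Prod.ext ?_ (funext fun i => ?_)
    · simp only [barQuotient]
      congr 1
      ext a
      simp only [Finset.mem_filter]
      refine and_congr_left fun hda => ?_
      rcases Nat.eq_zero_or_pos a with rfl | ha
      · exact iff_of_false q.zero_notMem lam.zero_notMem
      · rw [← bead_natCast q ha, ← bead_natCast lam ha, hq]
        have : (a : ZMod d) = 0 := (ZMod.natCast_eq_zero_iff a d).2 hda
        rw [Int.cast_natCast, this, charge_zero, mul_zero, add_zero]
    · obtain ⟨n, n', h1, h2, -, h4⟩ := run (i + 1) (by have := i.2; omega)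
      rw [barQuotient_snd q hd0 h1, barQuotient_snd lam hd0 h2, h4]

theorem IsBarQuotientPartition.unique {d : ℕ} (hd : Odd d) {lam q q' : BarPartition}
    (h : IsBarQuotientPartition d lam q) (h' : IsBarQuotientPartition d lam q') : q = q' := by
  have hd0 : 0 < d := hd.pos
  obtain ⟨hc, he⟩ := h
  obtain ⟨hc', he'⟩ := h'
  rw [isBarCore_empty_iff hd] at hc hc'
  rw [← he'] at he
  have key : ∀ (i : ℕ) (t : ℤ), 0 < i → i ≤ (d - 1) / 2 →
      (q.Bead (d * t + i) ↔ q'.Bead (d * t + i)) := by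
    intro i t hi0 hi
    have hid : i < d := by omega
    set n := q.part 0 + q'.part 0 + t.natAbs with hn
    have hn1 : q.part 0 ≤ n := by omega
    have hn2 : q'.part 0 ≤ n := by omega
    have e := congrFun (congrArg Prod.snd he) ⟨i - 1, by omega⟩
    rw [barQuotient_snd q hd0 hn1, barQuotient_snd q' hd0 hn2] at e
    simp only [show i - 1 + 1 = i by omega] at e
    have c1 := card_runner q hi0 hid hn1
    have c2 := card_runner q' hi0 hid hn2
    rw [hc] at c1
    rw [hc'] at c2
    have hY := eq_of_betaPartition (by omega) e
    have m1 := mem_runner_double q hid (hn1.trans (Nat.le_mul_of_pos_left n hd0)) (n + t).toNat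
    have m2 := mem_runner_double q' hid (hn2.trans (Nat.le_mul_of_pos_left n hd0)) (n + t).toNat
    rw [show (((n + t).toNat : ℕ) : ℤ) - n = t by omega] at m1 m2
    rw [← m1, ← m2, hY]
  refine ext_of_pos fun a ha => ?_
  by_cases hda : d ∣ a
  · have h1 : ∀ r : BarPartition, a ∈ r.parts ↔ a / d ∈ (barQuotient d r).1 := by
      intro r
      simp only [barQuotient, Finset.mem_image, Finset.mem_filter]
      constructor
      · exact fun h => ⟨a, ⟨h, hda⟩, rfl⟩
      · rintro ⟨b, ⟨hb, hdb⟩, hba⟩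
        rwa [← Nat.div_mul_cancel hda, ← hba, Nat.div_mul_cancel hdb]
    rw [h1, h1, he]
  have hm := Nat.div_add_mod a d
  have hlt := Nat.mod_lt a hd0
  have hr0 : 0 < a % d := Nat.pos_of_ne_zero fun h => hda (Nat.dvd_of_mod_eq_zero h)
  have hmz : (d : ℤ) * ((a / d : ℕ) : ℤ) + ((a % d : ℕ) : ℤ) = a := by exact_mod_cast hm
  rcases le_or_gt (a % d) ((d - 1) / 2) with h | h
  · have := key (a % d) (a / d : ℕ) hr0 h
    rwa [hmz, bead_natCast q ha, bead_natCast q' ha] at this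
  · have := key (d - a % d) (-((a / d : ℕ) : ℤ) - 1) (by omega) (by
      obtain ⟨r, hr⟩ := hd
      omega)
    have e : (d : ℤ) * (-((a / d : ℕ) : ℤ) - 1) + ((d - a % d : ℕ) : ℤ) = -(a : ℤ) := by
      rw [Nat.cast_sub hlt.le]
      linear_combination -hmz
    rw [e, bead_neg q (by omega), bead_neg q' (by omega), bead_natCast q ha,
      bead_natCast q' ha] at this
    exact not_iff_not.1 this

theorem existsUnique_isBarQuotientPartition {d : ℕ} (hd : Odd d) (lam : BarPartition) :
    ∃! q, IsBarQuotientPartition d lam q := by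
  obtain ⟨q, hq⟩ := exists_isBarQuotientPartition hd lam
  exact ⟨q, hq, fun q' hq' => hq'.unique hd hq⟩

/-- The `d̄`-core `c̄_d(λ)`, for odd `d`. -/
noncomputable def barCore (d : ℕ) (hd : Odd d) (lam : BarPartition) : BarPartition :=
  (existsUnique_isBarCore hd lam).choose

/-- The `d̄`-quotient partition `q̄_d(λ)`, for odd `d`: the unique bar partition with empty
`d̄`-core and the same `d̄`-quotient as `λ`. -/
noncomputable def barQuotientPartition (d : ℕ) (hd : Odd d) (lam : BarPartition) : BarPartition :=
  (existsUnique_isBarQuotientPartition hd lam).choose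

/-! ### Modified bar lengths -/

/-- The nodes of the shifted diagram `S(μ)` inside `D(μ)`; their hooks are the bars of `μ`. -/
def barNodes (mu : BarPartition) : Finset (ℕ × ℕ) := mu.double.cells.filter fun z => z.1 < z.2

/-- The nodes of `S(μ)` whose hooks correspond to the parts of `μ`: those of the column immediately
to the right of the last diagonal node of `D(μ)`. -/
def partNodes (mu : BarPartition) : Finset (ℕ × ℕ) := mu.barNodes.filter fun z => z.2 = mu.numParts

end BarPartition

/-- The length of the hook of `Y` at the node `z`. -/
def hookLen (Y : YoungDiagram) (z : ℕ × ℕ) : ℕ :=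
  (Y.rowLen z.1 - z.2 - 1) + (Y.colLen z.2 - z.1 - 1) + 1

/-- The `d`-residue `[c - r]_d` of the node in row `r` and column `c`. -/
def residue (d : ℕ) (z : ℕ × ℕ) : ℕ := (((z.2 : ℤ) - z.1) % d).toNat

/-- The `d`-residue of the hand node of the hook at `z`. -/
def handResidue (d : ℕ) (Y : YoungDiagram) (z : ℕ × ℕ) : ℕ := residue d (z.1, Y.rowLen z.1 - 1)

/-- The `d`-residue of the foot node of the hook at `z`. -/
def footResidue (d : ℕ) (Y : YoungDiagram) (z : ℕ × ℕ) : ℕ := residue d (Y.colLen z.2 - 1, z.2)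

namespace BarPartition

/-- The number `xᵢ` of beads on the `i`-th runner of the minimally normalized `d`-abacus
of `D(λ)`. -/
def beadCount (d : ℕ) (lam : BarPartition) (i : ℕ) : ℕ :=
  ((normBetaSet d lam.double).filter (· % d = i)).card

/-- The modified length `h(z) + (xᵢ - xⱼ) d` of the hook of `Y` at `z`, where `i` is the hand
residue, where `j` in `{0, …, d - 1}` is such that the foot residue is `[j + 1]_d`, and where the
`xᵢ` are the bead numbers of `D(λ)`. -/
def modHookLen (d : ℕ) (lam : BarPartition) (Y : YoungDiagram) (z : ℕ × ℕ) : ℤ :=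
  hookLen Y z + ((beadCount d lam (handResidue d Y z) : ℤ) -
    beadCount d lam ((footResidue d Y z + (d - 1)) % d)) * d

/-- The multiset `ℬ̄(q̄_d(λ))` of absolute values of the modified lengths of the bars
of `q̄_d(λ)`. -/
noncomputable def modBarLengths (d : ℕ) (hd : Odd d) (lam : BarPartition) : Multiset ℕ :=
  (barQuotientPartition d hd lam).barNodes.val.map fun z =>
    (modHookLen d lam (barQuotientPartition d hd lam).double z).natAbs

/-- The set `𝒫̄(q̄_d(λ))` of absolute values of the modified lengths of the hooks corresponding
to the parts of `q̄_d(λ)`. -/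
noncomputable def modParts (d : ℕ) (hd : Odd d) (lam : BarPartition) : Finset ℕ :=
  (barQuotientPartition d hd lam).partNodes.image fun z =>
    (modHookLen d lam (barQuotientPartition d hd lam).double z).natAbs

end BarPartition

/-!
# Bar lengths of a bar partition, its core and its quotient partition

The beads of the doubled partition form a set `B` of integers with `-z ∈ B ↔ z ∉ B` for `z ≠ 0` and
`0 ∉ B`, whose positive elements are the parts. Let `σ` be the permutation of `ℤ` that moves each
residue class modulo `d` by `d` times its charge (`shift`). It is odd, `σ⁻¹(B)` is the set of beads
of the quotient partition `q`, and `σ` maps the negative integers onto the beads of the core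
(`bead_barQuotientPartition`, `bead_barCore`). The bead numbers on the runners are the charges up to
a constant (`beadCount_eq`), so the modified length of a hook of `q` with bead `x` and gap `y` is
`σ x - σ y` (`modHookLen_eq`). The modified parts are therefore the `|σ a|`, and comparing the three
abaci at `σ z` shows that the parts of `λ` are the symmetric difference (`parts_eq_symmDiff`).

For the lengths, compare bars with hooks of the doubled partition, that is pairs of a bead `x` and a
gap `y < x`. The reflection `(x, y) ↦ (-y, -x)` pairs these, and the bars are the pairs with
`|y| < x`; with the exceptions `(a, 0)` and `(a, -a)` for the parts `a`, twice the bars are the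
hooks, for modified lengths as well (`hookLengthsVia_add`). For hooks there is an exact identity
(`hookLengthsVia_eq`): the hook lengths of `λ` are those of the core and the modified ones of `q`.
Indeed, for a fixed length `l > 0`, let `t = σ⁻¹ ∘ (σ - l)`. The hooks of `λ` of length `l` are the
`u` with `u` a bead and `t u` a gap of `q`. The difference of the two sides is a sum of
`excess u - excess (t u)` over the `u` with `u < t u`. These `u` form a union of residue classes,
and on each class the excess of beads of `q` sums to its charge `0`.

Together the two identities give `ℬ(λ) + I = ℬ(core) + ℬ̄(q) + 2 I`, where `I` is the set of common
elements of the parts of the core and the modified parts of `q`, and `2 I` is the set of their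
doubles (`barLengths_add_inter`). The inclusions follow as `I` lies in both multisets of bar
lengths, and equality holds if and only if `I = 2 I`, that is, if `I` is empty.
-/

namespace BarPartition

/-! ### The shift of the runners by the charges -/

/-- The permutation of the positions of the two-sided abacus that moves every runner by its
charge. It carries the beads of the `d̄`-quotient partition to those of `lam`, and the negative
positions to the beads of the `d̄`-core. -/
def shift (d : ℕ) (lam : BarPartition) (z : ℤ) : ℤ := z + d * charge d lam (z : ZMod d)

theorem intCast_shift (d : ℕ) (lam : BarPartition) (z : ℤ) :
    (shift d lam z : ZMod d) = (z : ZMod d) := by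
  simp [shift]

theorem shift_neg (d : ℕ) (lam : BarPartition) (z : ℤ) :
    shift d lam (-z) = -shift d lam z := by
  simp only [shift, Int.cast_neg, charge_neg]
  ring

theorem shift_zero (d : ℕ) (lam : BarPartition) : shift d lam 0 = 0 := by
  simp [shift, charge_zero]

theorem shift_injective (d : ℕ) (lam : BarPartition) : Function.Injective (shift d lam) := by
  intro x y h
  have hr : (x : ZMod d) = (y : ZMod d) := by
    rw [← intCast_shift d lam x, h, intCast_shift]
  simpa [shift, hr] using h

theorem shift_surjective (d : ℕ) (lam : BarPartition) : Function.Surjective (shift d lam) := by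
  intro z
  refine ⟨z - d * charge d lam (z : ZMod d), ?_⟩
  simp [shift]

/-- Undoing the shift of the runners makes all charges vanish and leaves the `d̄`-quotient
unchanged. -/
theorem isBarQuotientPartition_of_bead {d : ℕ} (hd : Odd d) {lam q : BarPartition}
    (hq : ∀ z : ℤ, q.Bead z ↔ lam.Bead (shift d lam z)) : IsBarQuotientPartition d lam q := by
  have hd0 : 0 < d := hd.pos
  have : NeZero d := ⟨hd0.ne'⟩
  have run : ∀ i < d, ∃ n n' : ℕ, q.part 0 ≤ n ∧ lam.part 0 ≤ n' ∧
      (n : ℤ) = n' + charge d lam (i : ZMod d) ∧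
      runner d (betaSet q.double (d * n)) i = runner d (betaSet lam.double (d * n')) i := by
    intro i hi
    have h1 := abs_le.1 (abs_charge_le d lam (i : ZMod d))
    refine ⟨(q.part 0 + lam.part 0 + lam.numParts + charge d lam (i : ZMod d)).toNat,
      q.part 0 + lam.part 0 + lam.numParts, by omega, by omega, by omega, ?_⟩
    exact runner_eq_of_bead hq hi
      (le_trans (by omega) (Nat.le_mul_of_pos_left _ hd0))
      (le_trans (by omega) (Nat.le_mul_of_pos_left _ hd0)) (by omega)
  refine ⟨(isBarCore_empty_iff hd q).2 fun i => ?_, ?_⟩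
  · by_cases hi0 : i = 0
    · rw [hi0, charge_zero]
    obtain ⟨n, n', h1, h2, h3, h4⟩ := run i.val i.val_lt
    have hv : 0 < i.val := Nat.pos_of_ne_zero fun h => hi0 ((ZMod.val_eq_zero i).1 h)
    have e1 := card_runner q hv i.val_lt h1
    have e2 := card_runner lam hv i.val_lt h2
    rw [ZMod.natCast_zmod_val] at e1 e2 h3
    rw [h4] at e1
    omega
  · refine Prod.ext ?_ (funext fun i => ?_)
    · simp only [barQuotient]
      congr 1
      ext a
      simp only [Finset.mem_filter]
      refine and_congr_left fun hda => ?_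
      rcases Nat.eq_zero_or_pos a with rfl | ha
      · exact iff_of_false q.zero_notMem lam.zero_notMem
      · rw [← bead_natCast q ha, ← bead_natCast lam ha, hq]
        have : (a : ZMod d) = 0 := (ZMod.natCast_eq_zero_iff a d).2 hda
        rw [shift, Int.cast_natCast, this, charge_zero, mul_zero, add_zero]
    · obtain ⟨n, n', h1, h2, -, h4⟩ := run (i + 1) (by have := i.2; omega)
      rw [barQuotient_snd q hd0 h1, barQuotient_snd lam hd0 h2, h4]

theorem barQuotientPartition_spec {d : ℕ} (hd : Odd d) (lam : BarPartition) :
    IsBarQuotientPartition d lam (lam.barQuotientPartition d hd) :=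
  (existsUnique_isBarQuotientPartition hd lam).choose_spec.1

theorem bead_barQuotientPartition {d : ℕ} (hd : Odd d) (lam : BarPartition) (z : ℤ) :
    (lam.barQuotientPartition d hd).Bead z ↔ lam.Bead (shift d lam z) := by
  obtain ⟨q, hq⟩ := exists_bead d lam
  rw [(barQuotientPartition_spec hd lam).unique hd (isBarQuotientPartition_of_bead hd hq)]
  exact hq z

theorem charge_barQuotientPartition {d : ℕ} (hd : Odd d) (lam : BarPartition) (i : ZMod d) :
    charge d (lam.barQuotientPartition d hd) i = 0 :=
  (isBarCore_empty_iff hd _).1 (barQuotientPartition_spec hd lam).1 i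

theorem bead_barCore {d : ℕ} (hd : Odd d) (lam : BarPartition) (z : ℤ) :
    (lam.barCore d hd).Bead (shift d lam z) ↔ z < 0 := by
  have hc : IsBarCore d lam (lam.barCore d hd) := (existsUnique_isBarCore hd lam).choose_spec.1
  have hd0 : (0 : ℤ) < d := by exact_mod_cast hd.pos
  have pos : ∀ z : ℤ, 0 < shift d lam z →
      ((lam.barCore d hd).Bead (shift d lam z) ↔ z < 0) := by
    intro z hz
    obtain ⟨a, ha⟩ : ∃ a : ℕ, shift d lam z = a := ⟨(shift d lam z).toNat, by omega⟩
    have hr : (a : ZMod d) = (z : ZMod d) := by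
      rw [← intCast_shift d lam z, ha, Int.cast_natCast]
    rw [ha, bead_natCast _ (by omega), mem_of_no_bar hd hc.2 (by omega), hc.charge_eq, hr,
      Int.natCast_div, Int.ediv_lt_iff_lt_mul hd0, ← ha, shift, mul_comm]
    omega
  rcases lt_trichotomy (shift d lam z) 0 with h | h | h
  · have h1 := pos (-z) (by rw [shift_neg]; omega)
    have h0 : z ≠ 0 := by
      rintro rfl
      rw [shift_zero] at h
      omega
    rw [shift_neg, bead_neg _ h.ne] at h1
    rw [← not_iff_not, h1]
    omega
  · have h0 : z = 0 := shift_injective d lam (by rw [h, shift_zero])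
    subst h0
    simp [shift_zero, Bead]
  · exact pos z h


/-! ### Bars as pairs of a bead and a gap -/

instance decidablePredBead (lam : BarPartition) : DecidablePred lam.Bead := fun _ =>
  inferInstanceAs (Decidable (_ ∨ _))

theorem bead_neg_natCast (lam : BarPartition) {a : ℕ} (ha : 0 < a) :
    lam.Bead (-(a : ℤ)) ↔ a ∉ lam.parts := by
  rw [bead_neg lam (by omega), bead_natCast lam ha]

theorem not_bead_zero (lam : BarPartition) : ¬ lam.Bead 0 := by
  simp [Bead]

theorem pos_of_mem_parts {lam : BarPartition} {a : ℕ} (ha : a ∈ lam.parts) : 0 < a :=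
  Nat.pos_of_ne_zero fun h0 => lam.zero_notMem (h0 ▸ ha)

theorem Bead.ne_zero {lam : BarPartition} {z : ℤ} (h : lam.Bead z) : z ≠ 0 := by
  rintro rfl
  exact lam.not_bead_zero h

theorem Bead.le_part {lam : BarPartition} {z : ℤ} (h : lam.Bead z) : z ≤ lam.part 0 := by
  rcases h with ⟨h1, h2⟩ | ⟨h1, h2⟩
  · have := lam.le_part_zero h2
    omega
  · omega

theorem neg_part_le_of_not_bead {lam : BarPartition} {z : ℤ} (h : ¬ lam.Bead z) :
    -(lam.part 0 : ℤ) ≤ z := by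
  rcases eq_or_ne z 0 with rfl | h0
  · omega
  · have := ((bead_neg lam h0).2 h).le_part
    omega

/-- The gaps `y` of the two-sided abacus with `|y| < a`. When `a` is a part, they index the bars
starting at `a`, with lengths `a - y`: a gap `y > 0` stands for replacing `a` by `y`, the gap `0`
for deleting `a`, and a gap `-b` for deleting the parts `a` and `b`. -/
noncomputable def gaps (lam : BarPartition) (a : ℕ) : Finset ℤ :=
  (Finset.Ioo (-(a : ℤ)) a).filter fun y => ¬ lam.Bead y

theorem mem_gaps {lam : BarPartition} {a : ℕ} {y : ℤ} :
    y ∈ lam.gaps a ↔ (-(a : ℤ) < y ∧ y < a) ∧ ¬ lam.Bead y := by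
  simp [gaps]

theorem zero_mem_gaps {lam : BarPartition} {a : ℕ} (ha : a ∈ lam.parts) : 0 ∈ lam.gaps a := by
  have := pos_of_mem_parts ha
  exact mem_gaps.2 ⟨by omega, lam.not_bead_zero⟩

/-- The lengths `a - y` for the gaps `y` make up the contribution of `a` in the definition of the
bar lengths, stated without subtraction of multisets. -/
theorem gaps_val_map (lam : BarPartition) (a : ℕ) :
    (lam.gaps a).val.map (fun y => ((a : ℤ) - y).natAbs) +
      (lam.parts.filter (· < a)).val.map (fun b => a - b) =
    (Finset.Icc 1 a).val + (lam.parts.filter (· < a)).val.map (fun b => a + b) := by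
  set P := lam.parts.filter (· < a) with hP
  have memP : ∀ b, b ∈ P ↔ b ∈ lam.parts ∧ b < a := fun b => by simp [hP]
  -- The nonnegative elements of the interval are gaps or parts; the negative gaps are the `-b`.
  have h1 : ((lam.gaps a).filter (0 ≤ ·)).val + P.val.map (fun b : ℕ => (b : ℤ)) =
      (Finset.Ico (0 : ℤ) a).val := by
    have hdis : Disjoint ((lam.gaps a).filter (0 ≤ ·)) (P.map Nat.castEmbedding) := by
      rw [Finset.disjoint_left]
      intro y hy hy2
      obtain ⟨b, hb, rfl⟩ := Finset.mem_map.1 hy2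
      have hb1 := (memP b).1 hb
      exact (mem_gaps.1 (Finset.mem_filter.1 hy).1).2
        ((bead_natCast lam (pos_of_mem_parts hb1.1)).2 hb1.1)
    have : (lam.gaps a).filter (0 ≤ ·) ∪ P.map Nat.castEmbedding = Finset.Ico (0 : ℤ) a := by
      ext y
      simp only [Finset.mem_union, Finset.mem_filter, mem_gaps, Finset.mem_map, memP,
        Nat.castEmbedding_apply, Finset.mem_Ico]
      constructor
      · rintro (h | ⟨b, hb, rfl⟩) <;> omega
      · rintro ⟨h0, h1⟩
        by_cases hy : lam.Bead y
        · right
          have hy0 := hy.ne_zero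
          obtain ⟨b, rfl⟩ : ∃ b : ℕ, y = b := ⟨y.toNat, by omega⟩
          exact ⟨b, ⟨(bead_natCast lam (by omega)).1 hy, by omega⟩, rfl⟩
        · left
          exact ⟨⟨⟨by omega, h1⟩, hy⟩, h0⟩
    rw [← this, ← Finset.disjUnion_eq_union _ _ hdis]
    rfl
  have h2 : ((lam.gaps a).filter (¬ 0 ≤ ·)).val = P.val.map (fun b : ℕ => -(b : ℤ)) := by
    have : (lam.gaps a).filter (¬ 0 ≤ ·) =
        P.map (Nat.castEmbedding.trans (Equiv.neg ℤ).toEmbedding) := by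
      ext y
      simp only [Finset.mem_filter, mem_gaps, Finset.mem_map, memP, Function.Embedding.trans_apply,
        Nat.castEmbedding_apply, Equiv.coe_toEmbedding, Equiv.neg_apply]
      constructor
      · rintro ⟨⟨h1, h2⟩, h3⟩
        obtain ⟨b, rfl⟩ : ∃ b : ℕ, y = -b := ⟨(-y).toNat, by omega⟩
        rw [bead_neg_natCast lam (by omega), not_not] at h2
        exact ⟨b, ⟨h2, by omega⟩, rfl⟩
      · rintro ⟨b, ⟨hb, hba⟩, rfl⟩
        have hb0 := pos_of_mem_parts hb
        rw [bead_neg_natCast lam hb0, not_not]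
        exact ⟨⟨by omega, hb⟩, by omega⟩
    rw [this]
    rfl
  have h3 : (Finset.Ico (0 : ℤ) a).val.map (fun y => ((a : ℤ) - y).natAbs) =
      (Finset.Icc 1 a).val := by
    rw [← Finset.image_val_of_injOn]
    · congr 1
      ext l
      simp only [Finset.mem_image, Finset.mem_Ico, Finset.mem_Icc]
      constructor
      · rintro ⟨y, hy, rfl⟩
        omega
      · intro hl
        exact ⟨a - l, by omega, by omega⟩
    · intro x hx y hy hxy
      simp only [Finset.coe_Ico, Set.mem_Ico] at hx hy hxy
      omega
  have h4 : (lam.gaps a).val = ((lam.gaps a).filter (0 ≤ ·)).val +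
      ((lam.gaps a).filter (¬ 0 ≤ ·)).val := by
    rw [Finset.filter_val, Finset.filter_val, Multiset.filter_add_not]
  rw [h4, h2, Multiset.map_add, Multiset.map_map, ← h3, ← h1, Multiset.map_add, Multiset.map_map,
    add_assoc, add_assoc]
  refine congrArg₂ _ rfl ((add_comm _ _).trans (congrArg₂ _ ?_ ?_))
  all_goals
    refine Multiset.map_congr rfl fun b hb => ?_
    have := (memP b).1 hb
    simp only [Function.comp_apply]
    omega

/-- Of two opposite positions exactly one is a gap, and `0` is one. -/
theorem card_gaps (lam : BarPartition) (a : ℕ) : (lam.gaps a).card = a := by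
  have := congrArg Multiset.card (gaps_val_map lam a)
  simpa using this

/-- The bar lengths, with every bar given by a part `a` and a gap `y`, `|y| < a`, and of length
`|w a - w y|` for a relabelling `w` of the positions. -/
noncomputable def barLengthsVia (w : ℤ → ℤ) (lam : BarPartition) : Multiset ℕ :=
  ∑ a ∈ lam.parts, (lam.gaps a).val.map fun y => (w a - w y).natAbs

theorem barLengths_eq (lam : BarPartition) : lam.barLengths = barLengthsVia id lam := by
  refine Finset.sum_congr rfl fun a _ => ?_
  rw [← gaps_val_map]
  exact add_tsub_cancel_right _ _

/-- The pairs of a bead and a gap below it: the hooks of the doubled partition. -/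
noncomputable def hooks (lam : BarPartition) : Finset (ℤ × ℤ) :=
  ((Finset.Icc (-(lam.part 0 : ℤ)) (lam.part 0)) ×ˢ
    (Finset.Icc (-(lam.part 0 : ℤ)) (lam.part 0))).filter
      fun p => lam.Bead p.1 ∧ ¬ lam.Bead p.2 ∧ p.2 < p.1

theorem mem_hooks {lam : BarPartition} {p : ℤ × ℤ} :
    p ∈ lam.hooks ↔ lam.Bead p.1 ∧ ¬ lam.Bead p.2 ∧ p.2 < p.1 := by
  simp only [hooks, Finset.mem_filter, Finset.mem_product, Finset.mem_Icc, and_iff_right_iff_imp]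
  rintro ⟨h1, h2, h3⟩
  have := h1.le_part
  have := neg_part_le_of_not_bead h2
  omega

/-- The bars are the hooks `(x, y)` with `|y| < x`. The reflection `(x, y) ↦ (-y, -x)` permutes the
hooks other than the `(a, 0)`, and fixes exactly the hooks `(a, -a)`, for the parts `a`. So, up to
these exceptions, the sum of an invariant function over the hooks is twice its sum over the bars. -/
theorem sum_hooks {M : Type*} [AddCommMonoid M] (lam : BarPartition) (φ : ℤ → ℤ → M)
    (hφ : ∀ x y, φ (-y) (-x) = φ x y) :
    ∑ p ∈ lam.hooks, φ p.1 p.2 + ∑ a ∈ lam.parts, φ a 0 =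
      2 • ∑ a ∈ lam.parts, ∑ y ∈ lam.gaps a, φ a y + ∑ a ∈ lam.parts, φ a (-a) := by
  have toNat_mem : ∀ z : ℤ, lam.Bead z → 0 < z → z.toNat ∈ lam.parts := fun z hz h0 => by
    rw [← bead_natCast lam (by omega), Int.toNat_of_nonneg h0.le]
    exact hz
  have hpos : ∑ p ∈ lam.hooks.filter (fun p => 0 < p.1 + p.2), φ p.1 p.2 =
      ∑ a ∈ lam.parts, ∑ y ∈ lam.gaps a, φ a y := by
    rw [Finset.sum_sigma']
    refine Finset.sum_bij' (fun p _ => ⟨p.1.toNat, p.2⟩) (fun s _ => ((s.1 : ℤ), s.2))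
      ?_ ?_ ?_ ?_ ?_
    · rintro ⟨x, y⟩ hp
      simp only [Finset.mem_filter, mem_hooks] at hp
      rw [Finset.mem_sigma, mem_gaps]
      exact ⟨toNat_mem x hp.1.1 (by omega), by dsimp only; omega, hp.1.2.1⟩
    · rintro ⟨a, y⟩ hs
      rw [Finset.mem_sigma, mem_gaps] at hs
      simp only [Finset.mem_filter, mem_hooks]
      have h0 := pos_of_mem_parts hs.1
      have h1 := hs.2.1.1
      dsimp only at h1
      exact ⟨⟨(bead_natCast lam h0).2 hs.1, hs.2.2, hs.2.1.2⟩, by omega⟩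
    · rintro ⟨x, y⟩ hp
      simp only [Finset.mem_filter, mem_hooks] at hp
      simp only [Prod.mk.injEq, and_true]
      omega
    · rintro ⟨a, y⟩ _
      simp
    · rintro ⟨x, y⟩ hp
      simp only [Finset.mem_filter, mem_hooks] at hp
      simp only
      rw [Int.toNat_of_nonneg (by omega)]
  have hdiag : ∑ p ∈ lam.hooks.filter (fun p => p.1 + p.2 = 0), φ p.1 p.2 =
      ∑ a ∈ lam.parts, φ a (-a) := by
    refine Finset.sum_bij' (fun p _ => p.1.toNat) (fun a _ => ((a : ℤ), -(a : ℤ))) ?_ ?_ ?_ ?_ ?_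
    · rintro ⟨x, y⟩ hp
      simp only [Finset.mem_filter, mem_hooks] at hp
      exact toNat_mem x hp.1.1 (by omega)
    · intro a ha
      have h0 := pos_of_mem_parts ha
      simp only [Finset.mem_filter, mem_hooks, bead_neg_natCast lam h0, bead_natCast lam h0]
      exact ⟨⟨ha, not_not.2 ha, by omega⟩, by omega⟩
    · rintro ⟨x, y⟩ hp
      simp only [Finset.mem_filter, mem_hooks] at hp
      simp only [Prod.mk.injEq]
      omega
    · intro a _
      simp
    · rintro ⟨x, y⟩ hp
      simp only [Finset.mem_filter, mem_hooks] at hp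
      simp only
      rw [Int.toNat_of_nonneg (by omega), show y = -x by omega]
  have hneg : ∑ p ∈ lam.hooks.filter (fun p => p.1 + p.2 < 0), φ p.1 p.2 +
      ∑ a ∈ lam.parts, φ a 0 =
      ∑ p ∈ lam.hooks.filter (fun p => 0 < p.1 + p.2), φ p.1 p.2 := by
    rw [← Finset.sum_filter_add_sum_filter_not (lam.hooks.filter (fun p => 0 < p.1 + p.2))
      (fun p => p.2 ≠ 0)]
    congr 1
    · -- the reflection `(x, y) ↦ (-y, -x)` swaps beads and gaps away from `0`
      refine Finset.sum_bij' (fun p _ => (-p.2, -p.1)) (fun p _ => (-p.2, -p.1)) ?_ ?_ ?_ ?_ ?_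
      · rintro ⟨x, y⟩ hp
        simp only [Finset.mem_filter, mem_hooks] at hp ⊢
        have hx := hp.1.1.ne_zero
        rw [bead_neg lam hx, bead_neg lam (by omega)]
        exact ⟨⟨⟨hp.1.2.1, not_not.2 hp.1.1, by omega⟩, by omega⟩, by omega⟩
      · rintro ⟨x, y⟩ hp
        simp only [Finset.mem_filter, mem_hooks] at hp ⊢
        have hx := hp.1.1.1.ne_zero
        rw [bead_neg lam hx, bead_neg lam hp.2]
        exact ⟨⟨hp.1.1.2.1, not_not.2 hp.1.1.1, by omega⟩, by omega⟩
      · simp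
      · simp
      · intro p _
        exact (hφ _ _).symm
    · refine Finset.sum_bij' (fun a _ => ((a : ℤ), 0)) (fun p _ => p.1.toNat) ?_ ?_ ?_ ?_ ?_
      · intro a ha
        have h0 := pos_of_mem_parts ha
        simp only [Finset.mem_filter, mem_hooks, bead_natCast lam h0]
        exact ⟨⟨⟨ha, lam.not_bead_zero, by omega⟩, by omega⟩, by simp⟩
      · rintro ⟨x, y⟩ hp
        simp only [Finset.mem_filter, mem_hooks] at hp
        exact toNat_mem x hp.1.1.1 (by omega)
      · simp
      · rintro ⟨x, y⟩ hp
        simp only [Finset.mem_filter, mem_hooks] at hp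
        simp only [Prod.mk.injEq]
        omega
      · simp
  have hsplit : ∑ p ∈ lam.hooks, φ p.1 p.2 =
      ∑ p ∈ lam.hooks.filter (fun p => 0 < p.1 + p.2), φ p.1 p.2 +
      (∑ p ∈ lam.hooks.filter (fun p => p.1 + p.2 = 0), φ p.1 p.2 +
      ∑ p ∈ lam.hooks.filter (fun p => p.1 + p.2 < 0), φ p.1 p.2) := by
    rw [← Finset.sum_filter_add_sum_filter_not lam.hooks (fun p => 0 < p.1 + p.2),
      ← Finset.sum_filter_add_sum_filter_not (lam.hooks.filter fun p => ¬ 0 < p.1 + p.2)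
        (fun p => p.1 + p.2 = 0), Finset.filter_filter, Finset.filter_filter]
    congr 3 <;> ext p <;> simp only [Finset.mem_filter] <;> refine and_congr_right fun _ => ?_ <;>
      omega
  rw [hsplit, hdiag, add_assoc, add_assoc, hneg, hpos, two_nsmul]
  abel

/-- The hook lengths of the doubled partition, relabelled by `w`. -/
noncomputable def hookLengthsVia (w : ℤ → ℤ) (lam : BarPartition) : Multiset ℕ :=
  lam.hooks.val.map fun p => (w p.1 - w p.2).natAbs

theorem sum_singleton_eq_map {α : Type*} (s : Finset α) (f : α → ℕ) :
    ∑ i ∈ s, ({f i} : Multiset ℕ) = s.val.map f := by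
  rw [← Multiset.sum_map_singleton (s.val.map f), Multiset.map_map]
  rfl

/-- Every bar is counted by two hooks of the doubled partition, up to the hooks given by `(a, 0)`
and `(a, -a)` for the parts `a`. -/
theorem hookLengthsVia_add {w : ℤ → ℤ} (hw : ∀ z, w (-z) = -w z) (lam : BarPartition) :
    hookLengthsVia w lam + lam.parts.val.map (fun a : ℕ => (w a).natAbs) =
      2 • barLengthsVia w lam + (lam.parts.val.map (fun a : ℕ => (w a).natAbs)).map (2 * ·) := by
  have h := sum_hooks lam (fun x y => ({(w x - w y).natAbs} : Multiset ℕ)) (fun x y => by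
    simp only [hw]
    congr 2
    ring)
  have w0 : w 0 = 0 := by
    have := hw 0
    rw [neg_zero] at this
    omega
  simp only [sum_singleton_eq_map, w0, sub_zero, hw] at h
  rw [Multiset.map_map]
  refine h.trans (congrArg₂ _ rfl (Multiset.map_congr rfl fun a _ => ?_))
  simp only [Function.comp_apply]
  omega

theorem parts_map_le_barLengthsVia {w : ℤ → ℤ} (w0 : w 0 = 0) (lam : BarPartition) :
    lam.parts.val.map (fun a : ℕ => (w a).natAbs) ≤ barLengthsVia w lam := by
  rw [← sum_singleton_eq_map]
  refine Finset.sum_le_sum fun a ha => ?_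
  rw [Multiset.singleton_le]
  exact Multiset.mem_map.2 ⟨0, zero_mem_gaps ha, by rw [w0, sub_zero]⟩


/-! ### Hook lengths of the doubled partition, its core and its quotient -/

theorem card_eq_finsum_of_injOn {α : Type*} {S : Finset α} {f : α → ℤ} (hf : Set.InjOn f S)
    {P : ℤ → Prop} [DecidablePred P] (hP : ∀ u, P u ↔ ∃ p ∈ S, f p = u) :
    (fun u => if P u then (1 : ℤ) else 0).support.Finite ∧
      ∑ᶠ u, (if P u then (1 : ℤ) else 0) = S.card := by
  have hs : (fun u => if P u then (1 : ℤ) else 0).support ⊆ ↑(S.image f) := by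
    intro u hu
    have : P u := by
      by_contra h
      simp [h] at hu
    simpa using (hP u).1 this
  refine ⟨(Finset.finite_toSet _).subset hs, ?_⟩
  rw [finsum_eq_sum_of_support_subset _ hs, Finset.sum_image hf, Finset.card_eq_sum_ones]
  push_cast
  exact Finset.sum_congr rfl fun p hp => if_pos ((hP _).2 ⟨p, hp, rfl⟩)

/-- The excess of beads at `u` over the abacus of the empty partition. -/
def excess (lam : BarPartition) (u : ℤ) : ℤ :=
  (if lam.Bead u then 1 else 0) - (if u < 0 then 1 else 0)

theorem support_excess_subset (lam : BarPartition) {g : ℤ → ℤ} :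
    (fun u => g u * lam.excess u).support ⊆ ↑(lam.parts.image (fun a : ℕ => (a : ℤ)) ∪
      lam.parts.image (fun a : ℕ => -(a : ℤ))) := by
  intro u hu
  have hu0 : lam.excess u ≠ 0 := fun h => by simp [h] at hu
  rw [Finset.coe_union, Set.mem_union, Finset.mem_coe, Finset.mem_coe, Finset.mem_image,
    Finset.mem_image]
  rcases lt_trichotomy u 0 with h | h | h
  · right
    obtain ⟨a, rfl⟩ : ∃ a : ℕ, u = -a := ⟨(-u).toNat, by omega⟩
    refine ⟨a, ?_, rfl⟩
    by_contra ha
    simp [excess, (bead_neg_natCast lam (show 0 < a by omega)).2 ha] at hu0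
    omega
  · subst h
    simp [excess, lam.not_bead_zero] at hu0
  · left
    obtain ⟨a, rfl⟩ : ∃ a : ℕ, u = a := ⟨u.toNat, by omega⟩
    refine ⟨a, ?_, rfl⟩
    by_contra ha
    simp [excess, bead_natCast lam (show 0 < a by omega), ha, h.not_gt] at hu0

theorem finsum_mul_excess (lam : BarPartition) (g : ℤ → ℤ) :
    ∑ᶠ u, g u * lam.excess u = ∑ a ∈ lam.parts, (g a - g (-a)) := by
  rw [finsum_eq_sum_of_support_subset _ lam.support_excess_subset, Finset.sum_union,
    Finset.sum_image, Finset.sum_image, ← Finset.sum_add_distrib]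
  · refine Finset.sum_congr rfl fun a ha => ?_
    have h0 := pos_of_mem_parts ha
    have h1 : ¬ ((a : ℤ) < 0) := by omega
    have h2 : -(a : ℤ) < 0 := by omega
    simp only [excess, bead_natCast lam h0, bead_neg_natCast lam h0, ha, h1, h2, if_true, if_false,
      not_true_eq_false]
    ring
  · intro a _ b _ h
    simpa using h
  · intro a _ b _ h
    simpa using h
  · rw [Finset.disjoint_left]
    intro u h1 h2
    obtain ⟨a, ha, rfl⟩ := Finset.mem_image.1 h1
    obtain ⟨b, hb, h⟩ := Finset.mem_image.1 h2
    have := pos_of_mem_parts ha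
    omega

/-- If all charges vanish, the excess of beads has sum `0` on every runner. -/
theorem finsum_residue_mul_excess {d : ℕ} [NeZero d] {lam : BarPartition}
    (h : ∀ i, charge d lam i = 0) (g : ZMod d → ℤ) :
    ∑ᶠ u : ℤ, g (u : ZMod d) * lam.excess u = 0 := by
  rw [lam.finsum_mul_excess (fun u => g (u : ZMod d))]
  have e : ∀ a : ℕ, g ((a : ℤ) : ZMod d) - g ((-(a : ℤ) : ℤ) : ZMod d) =
      ∑ i, g i * ((if (a : ZMod d) = i then 1 else 0) - (if (a : ZMod d) = -i then 1 else 0)) := by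
    intro a
    have e2 : ∀ i : ZMod d, ((a : ZMod d) = -i) ↔ (-(a : ZMod d) = i) := fun i =>
      neg_eq_iff_eq_neg.symm
    simp [mul_sub, Finset.sum_sub_distrib, e2]
  simp only [e]
  rw [Finset.sum_comm]
  refine Finset.sum_eq_zero fun i _ => ?_
  rw [← Finset.mul_sum]
  exact mul_eq_zero_of_right _ (h i)

theorem count_hookLengthsVia (w : ℤ → ℤ) (lam : BarPartition) (l : ℕ) :
    (hookLengthsVia w lam).count l =
      (lam.hooks.filter fun p => (w p.1 - w p.2).natAbs = l).card := by
  rw [hookLengthsVia, Multiset.count_map, Finset.card, Finset.filter_val]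
  simp only [eq_comm]

theorem count_zero_hookLengthsVia {w : ℤ → ℤ} (hw : Function.Injective w) (lam : BarPartition) :
    (hookLengthsVia w lam).count 0 = 0 := by
  rw [count_hookLengthsVia, Finset.card_eq_zero, Finset.filter_eq_empty_iff]
  intro p hp h
  have h1 : p.1 = p.2 := hw (by omega)
  have h2 := (mem_hooks.1 hp).2.2
  omega

/-- The hooks of length `l`, indexed by their beads. The beads are labelled by a bijection `w`, and
`t u` is the label of the position `l` below the one of label `u`. -/
theorem finsum_hooks {w t : ℤ → ℤ} (hw : Function.Bijective w) {l : ℕ} (hl : 0 < l)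
    (ht : ∀ u, w (t u) = w u - l) (lam : BarPartition) :
    (fun u => if lam.Bead (w u) ∧ ¬ lam.Bead (w (t u)) then (1 : ℤ) else 0).support.Finite ∧
    ∑ᶠ u, (if lam.Bead (w u) ∧ ¬ lam.Bead (w (t u)) then (1 : ℤ) else 0) =
      (hookLengthsVia id lam).count l := by
  rw [count_hookLengthsVia]
  refine card_eq_finsum_of_injOn (f := fun p => (Equiv.ofBijective w hw).symm p.1) ?_ ?_
  · rintro ⟨x, y⟩ hp ⟨x', y'⟩ hp' h
    simp only [Finset.coe_filter, mem_hooks, Set.mem_ofPred_eq, id] at hp hp'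
    have : x = x' := by simpa using h
    simp only [Prod.mk.injEq]
    omega
  · intro u
    simp only [Finset.mem_filter, mem_hooks, id, Equiv.symm_apply_eq, Equiv.ofBijective_apply]
    constructor
    · intro h
      exact ⟨(w u, w (t u)), ⟨⟨h.1, h.2, by simp only [ht]; omega⟩, by simp only [ht]; omega⟩, rfl⟩
    · rintro ⟨⟨x, y⟩, ⟨⟨h1, h2, h3⟩, h4⟩, rfl⟩
      have : w (t u) = y := by
        rw [ht]
        simp only at h3 h4 ⊢
        omega
      exact ⟨h1, this ▸ h2⟩

/-- The hooks of modified length `l`: the difference of the labels of bead and gap has either sign,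
and each hook is indexed by its position of larger label. -/
theorem finsum_hooksVia {w t : ℤ → ℤ} (hw : Function.Bijective w) {l : ℕ} (hl : 0 < l)
    (ht : ∀ u, w (t u) = w u - l) (lam : BarPartition) :
    (fun u => if (lam.Bead u ∧ ¬ lam.Bead (t u) ∧ t u < u) ∨
        (¬ lam.Bead u ∧ lam.Bead (t u) ∧ u < t u)
      then (1 : ℤ) else 0).support.Finite ∧
    ∑ᶠ u, (if (lam.Bead u ∧ ¬ lam.Bead (t u) ∧ t u < u) ∨ (¬ lam.Bead u ∧ lam.Bead (t u) ∧ u < t u)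
      then (1 : ℤ) else 0) = (hookLengthsVia w lam).count l := by
  have t_eq : ∀ u v, w u - w v = l ↔ v = t u := fun u v => by
    rw [← hw.injective.eq_iff (a := v), ht]
    omega
  rw [count_hookLengthsVia]
  refine card_eq_finsum_of_injOn (f := fun p => if w p.2 < w p.1 then p.1 else p.2) ?_ ?_
  · rintro ⟨x, y⟩ hp ⟨x', y'⟩ hp' h
    simp only [Finset.coe_filter, mem_hooks, Set.mem_ofPred_eq] at hp hp' h
    simp only [Prod.mk.injEq]
    split_ifs at h with h1 h2 h2
    · subst h
      exact ⟨rfl, hw.injective (by omega)⟩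
    · subst h
      exact absurd hp.1.1 hp'.1.2.1
    · subst h
      exact absurd hp'.1.1 hp.1.2.1
    · subst h
      exact ⟨hw.injective (by omega), rfl⟩
  · intro u
    have htu := ht u
    simp only [Finset.mem_filter, mem_hooks]
    constructor
    · rintro (h | h)
      · exact ⟨(u, t u), ⟨h, by simp only; omega⟩, if_pos (by simp only; omega)⟩
      · exact ⟨(t u, u), ⟨⟨h.2.1, h.1, h.2.2⟩, by simp only; omega⟩, if_neg (by simp only; omega)⟩
    · rintro ⟨⟨x, y⟩, ⟨⟨h1, h2, h3⟩, h4⟩, rfl⟩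
      simp only at h1 h2 h3 h4
      rcases lt_or_ge (w y) (w x) with h | h
      · left
        simp only [h, if_true]
        rw [← (t_eq x y).1 (by omega)]
        exact ⟨h1, h2, h3⟩
      · right
        simp only [h.not_gt, if_false]
        rw [← (t_eq y x).1 (by omega)]
        exact ⟨h2, h1, h3⟩

/-- The hook lengths of the doubled partition of `lam` are those of the doubled core together with
the modified hook lengths of the doubled quotient partition. -/
theorem hookLengthsVia_eq {d : ℕ} (hd : Odd d) (lam : BarPartition) :
    hookLengthsVia id lam = hookLengthsVia id (lam.barCore d hd) +
      hookLengthsVia (shift d lam) (lam.barQuotientPartition d hd) := by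
  have : NeZero d := ⟨hd.pos.ne'⟩
  have hw : Function.Bijective (shift d lam) := ⟨shift_injective d lam, shift_surjective d lam⟩
  ext l
  rw [Multiset.count_add]
  rcases Nat.eq_zero_or_pos l with rfl | hl
  · rw [count_zero_hookLengthsVia Function.injective_id,
      count_zero_hookLengthsVia Function.injective_id, count_zero_hookLengthsVia hw.injective]
  let e := Equiv.ofBijective _ hw
  let t : ℤ ≃ ℤ := e.trans ((Equiv.subRight (l : ℤ)).trans e.symm)
  have ht : ∀ u, shift d lam (t u) = shift d lam u - l := fun u =>
    e.apply_symm_apply _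
  -- the displacement `t u - u` depends only on the runner of `u`
  have hres : ∀ u, ((t u : ℤ) : ZMod d) = (u : ZMod d) - l := fun u => by
    rw [← intCast_shift d lam (t u), ht]
    push_cast
    rw [intCast_shift]
  let δ : ZMod d → ℤ := fun i => d * (charge d lam i - charge d lam (i - l)) - l
  have hδ : ∀ u, t u = u + δ (u : ZMod d) := fun u => by
    have h1 := ht u
    simp only [shift, hres] at h1
    simp only [δ]
    linear_combination h1
  let g : ZMod d → ℤ := fun i => if 0 < δ i then 1 else 0
  set q := lam.barQuotientPartition d hd with hq
  have hc := charge_barQuotientPartition hd lam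
  obtain ⟨f1, s1⟩ := finsum_hooks hw hl ht lam
  obtain ⟨f2, s2⟩ := finsum_hooks hw hl ht (lam.barCore d hd)
  obtain ⟨f3, s3⟩ := finsum_hooksVia hw hl ht q
  have z1 : ∑ᶠ u : ℤ, g (u : ZMod d) * q.excess u = 0 := finsum_residue_mul_excess hc g
  have z2 : ∑ᶠ u : ℤ, g (u : ZMod d) * q.excess (t u) = 0 := by
    rw [← finsum_residue_mul_excess hc (fun i => g (i + l)),
      ← finsum_comp_equiv t (f := fun u : ℤ => g ((u : ZMod d) + l) * q.excess u)]
    simp only [hres, sub_add_cancel]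
  have f4 : (fun u : ℤ => g (u : ZMod d) * q.excess u).support.Finite :=
    (Finset.finite_toSet _).subset (q.support_excess_subset)
  have f5 : (fun u : ℤ => g (u : ZMod d) * q.excess (t u)).support.Finite := by
    refine ((Finset.finite_toSet _).subset
      (q.support_excess_subset (g := fun _ => 1))).preimage (f := t) t.injective.injOn |>.subset ?_
    intro u hu h
    simp only [one_mul] at h
    simp [h] at hu
  have key := finsum_add_distrib f1 f5
  have key2 := finsum_add_distrib f2 f3
  have key3 := finsum_add_distrib (f2.union f3 |>.subset (Function.support_add _ _)) f4
  have hpt : ∀ u : ℤ, (if lam.Bead (shift d lam u) ∧ ¬ lam.Bead (shift d lam (t u)) then (1 : ℤ)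
      else 0) + g (u : ZMod d) * q.excess (t u) =
      ((if (lam.barCore d hd).Bead (shift d lam u) ∧ ¬ (lam.barCore d hd).Bead (shift d lam (t u))
        then (1 : ℤ) else 0) +
      (if (q.Bead u ∧ ¬ q.Bead (t u) ∧ t u < u) ∨ (¬ q.Bead u ∧ q.Bead (t u) ∧ u < t u)
        then (1 : ℤ) else 0)) + g (u : ZMod d) * q.excess u := fun u => by
    have hne : t u ≠ u := fun h => by
      have := ht u
      rw [h] at this
      omega
    have hg : g (u : ZMod d) = if u < t u then 1 else 0 := by
      simp only [g, hδ u, lt_add_iff_pos_right]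
    rw [hg]
    simp only [excess, ← bead_barQuotientPartition hd lam, ← hq, bead_barCore]
    by_cases h1 : q.Bead u <;> by_cases h2 : q.Bead (t u) <;>
      rcases lt_or_gt_of_ne hne with h3 | h3 <;>
      simp only [h1, h2, h3, h3.not_gt, not_true_eq_false, not_false_eq_true, and_true,
        and_false, or_false, false_or, if_true, if_false] <;>
      split_ifs <;> omega
  have h := finsum_congr hpt
  rw [key, key3, key2, s1, s2, s3, z1, z2] at h
  omega


/-! ### Modified hook lengths in terms of positions on the abacus -/

/-- The bead numbers are the charges, up to a constant. -/
theorem beadCount_eq {d : ℕ} [NeZero d] (lam : BarPartition) {i : ℕ} (hi : i < d) :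
    (beadCount d lam i : ℤ) = ((lam.part 0 + d - 1) / d : ℕ) + charge d lam (i : ZMod d) := by
  have hd : 0 < d := Nat.pos_of_neZero d
  set n := (lam.part 0 + d - 1) / d with hn
  have hN : lam.part 0 ≤ d * n := by
    have h1 := Nat.div_add_mod (lam.part 0 + d - 1) d
    have h2 := Nat.mod_lt (lam.part 0 + d - 1) hd
    rw [← hn] at h1
    omega
  have key : ∀ x : ℕ, x % d = i ↔ (((x : ℤ) - (d * n : ℕ) : ℤ) : ZMod d) = i := fun x => by
    push_cast
    rw [ZMod.natCast_self, zero_mul, sub_zero, ZMod.natCast_eq_natCast_iff', Nat.mod_eq_of_lt hi]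
  let g : ℤ → ℤ := fun u => if (u : ZMod d) = i then 1 else 0
  set I := Finset.Icc (-(d * n : ℕ) : ℤ) (d * n : ℕ) with hI
  have h1 : (beadCount d lam i : ℤ) = ∑ u ∈ I, g u * (if lam.Bead u then 1 else 0) := by
    have e : beadCount d lam i =
        (I.filter fun u : ℤ => (u : ZMod d) = i ∧ lam.Bead u).card := by
      rw [beadCount, normBetaSet, normSize, colLen_double_zero, ← hn]
      refine Finset.card_nbij' (fun x => (x : ℤ) - (d * n : ℕ)) (fun u => (u + (d * n : ℕ)).toNat)
        ?_ ?_ ?_ ?_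
      · intro x hx
        simp only [Finset.coe_filter, Set.mem_ofPred_eq, mem_betaSet_double lam hN, key] at hx
        simp only [Finset.coe_filter, Set.mem_ofPred_eq, hI, Finset.mem_Icc]
        have := hx.1.le_part
        exact ⟨by omega, hx.2, hx.1⟩
      · intro u hu
        simp only [Finset.coe_filter, Set.mem_ofPred_eq, hI, Finset.mem_Icc] at hu
        simp only [Finset.coe_filter, Set.mem_ofPred_eq, mem_betaSet_double lam hN, key]
        rw [Int.toNat_of_nonneg (by omega), add_sub_cancel_right]
        exact ⟨hu.2.2, hu.2.1⟩
      · intro x _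
        simp
      · intro u hu
        simp only [Finset.coe_filter, Set.mem_ofPred_eq, hI, Finset.mem_Icc] at hu
        simp only
        omega
    rw [e, Finset.card_filter]
    push_cast
    refine Finset.sum_congr rfl fun u _ => ?_
    simp only [g]
    split_ifs <;> simp_all
  have h2 : ∑ u ∈ I, g u * lam.excess u = charge d lam (i : ZMod d) := by
    rw [← finsum_eq_sum_of_support_subset (fun u => g u * lam.excess u), finsum_mul_excess, charge]
    · refine Finset.sum_congr rfl fun a _ => ?_
      simp only [g, Int.cast_neg, Int.cast_natCast, neg_eq_iff_eq_neg]
    · refine lam.support_excess_subset.trans ?_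
      intro u hu
      rw [Finset.coe_union, Set.mem_union, Finset.mem_coe, Finset.mem_coe, Finset.mem_image,
        Finset.mem_image] at hu
      rw [Finset.mem_coe, hI, Finset.mem_Icc]
      rcases hu with ⟨a, ha, rfl⟩ | ⟨a, ha, rfl⟩ <;>
      · have := lam.le_part_zero ha
        omega
  have h3 : ∑ u ∈ I, g u * (if u < 0 then 1 else 0) = n := by
    have e : ∑ u ∈ I, g u * (if u < 0 then 1 else 0) =
        ((I.filter fun u : ℤ => (u : ZMod d) = i ∧ u < 0).card : ℤ) := by
      rw [Finset.card_filter]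
      push_cast
      refine Finset.sum_congr rfl fun u _ => ?_
      simp only [g]
      split_ifs <;> simp_all
    have e2 : (I.filter fun u : ℤ => (u : ZMod d) = i ∧ u < 0) =
        (Finset.Ico (-(d * n : ℕ) : ℤ) 0).filter fun u => u ≡ i [ZMOD d] := by
      ext u
      simp only [hI, Finset.mem_filter, Finset.mem_Icc, Finset.mem_Ico,
        ← ZMod.intCast_eq_intCast_iff, Int.cast_natCast]
      constructor
      · rintro ⟨h1, h2, h3⟩
        exact ⟨by omega, h2⟩
      · rintro ⟨h1, h2⟩
        exact ⟨by omega, h2, by omega⟩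
    rw [e, e2, Int.Ico_filter_modEq_card _ _ (by exact_mod_cast hd)]
    have hdq : (d : ℚ) ≠ 0 := by exact_mod_cast hd.ne'
    have e3 : ((-(d * n : ℕ) : ℤ) - ((i : ℤ) : ℚ)) / ((d : ℤ) : ℚ) =
        (((0 : ℤ) : ℚ) - ((i : ℤ) : ℚ)) / ((d : ℤ) : ℚ) - (n : ℕ) := by
      push_cast
      field_simp
      ring
    rw [e3, Int.ceil_sub_natCast, sub_sub_cancel]
    exact max_eq_left (Int.natCast_nonneg n)
  rw [h1, ← h2, ← h3, ← Finset.sum_add_distrib]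
  refine Finset.sum_congr rfl fun u _ => ?_
  rw [excess]
  ring

theorem natCast_residue {d : ℕ} [NeZero d] (z : ℕ × ℕ) :
    (residue d z : ZMod d) = (z.2 : ZMod d) - z.1 := by
  have hd : (0 : ℤ) < d := by exact_mod_cast Nat.pos_of_neZero d
  have h : ((residue d z : ℕ) : ℤ) = ((z.2 : ℤ) - z.1) % d :=
    Int.toNat_of_nonneg (Int.emod_nonneg _ hd.ne')
  have h2 := congrArg (fun x : ℤ => (x : ZMod d)) h
  simpa using h2

theorem residue_lt {d : ℕ} [NeZero d] (z : ℕ × ℕ) : residue d z < d := by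
  have hd : (0 : ℤ) < d := by exact_mod_cast Nat.pos_of_neZero d
  have := Int.emod_lt_of_pos ((z.2 : ℤ) - z.1) hd
  have := Int.emod_nonneg ((z.2 : ℤ) - z.1) hd.ne'
  unfold residue
  omega

/-- Rows and columns are indexed from `0`: row `i` contains the `mu.part i` bar nodes
`(i, i + 1), …, (i, i + mu.part i)`. -/
theorem mem_barNodes {mu : BarPartition} {i j : ℕ} :
    (i, j) ∈ mu.barNodes ↔ i < mu.numParts ∧ i < j ∧ j ≤ i + mu.part i := by
  simp only [barNodes, Finset.mem_filter, YoungDiagram.mem_cells, mem_double]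
  constructor
  · rintro ⟨h1, h2⟩
    refine ⟨?_, h2, by omega⟩
    by_contra hc
    rw [mu.part_eq_zero (not_lt.1 hc)] at h1
    omega
  · omega

theorem lt_colLen_double {mu : BarPartition} {i j : ℕ} (h : (i, j) ∈ mu.barNodes) :
    i < mu.double.colLen j := by
  rw [← YoungDiagram.mem_iff_lt_colLen, ← YoungDiagram.mem_cells]
  exact (Finset.mem_filter.1 h).1

/-- The hook at the node `(i, j)` above the diagonal is given by the bead `mu.part i` and the gap
`j - (colLen j)`; its hand residue is that of the bead, its foot residue that of the gap
plus one. -/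
theorem modHookLen_eq {d : ℕ} [NeZero d] (lam : BarPartition) {mu : BarPartition} {i j : ℕ}
    (h : (i, j) ∈ mu.barNodes) :
    modHookLen d lam mu.double (i, j) =
      shift d lam (mu.part i) - shift d lam ((j : ℤ) - mu.double.colLen j) := by
  have hd : 0 < d := Nat.pos_of_neZero d
  have hc := lt_colLen_double h
  obtain ⟨h1, h2, h3⟩ := mem_barNodes.1 h
  have hr := mu.rowLen_double_of_lt h1
  have e1 : (handResidue d mu.double (i, j) : ZMod d) = ((mu.part i : ℤ) : ZMod d) := by
    rw [handResidue, natCast_residue, hr, show i + 1 + mu.part i - 1 = i + mu.part i by omega]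
    push_cast
    ring
  have e2 : (((footResidue d mu.double (i, j) + (d - 1)) % d : ℕ) : ZMod d) =
      (((j : ℤ) - mu.double.colLen j : ℤ) : ZMod d) := by
    rw [ZMod.natCast_mod, Nat.cast_add, Nat.cast_sub hd, footResidue, natCast_residue,
      Nat.cast_sub (show 1 ≤ mu.double.colLen j by omega)]
    push_cast
    rw [ZMod.natCast_self]
    ring
  have e3 : (hookLen mu.double (i, j) : ℤ) = mu.part i - ((j : ℤ) - mu.double.colLen j) := by
    simp only [hookLen, hr]
    omega
  have hlt : handResidue d mu.double (i, j) < d := residue_lt _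
  rw [modHookLen, beadCount_eq lam hlt, beadCount_eq lam (Nat.mod_lt _ hd), e1, e2, e3,
    shift, shift]
  ring

/-- The columns of the double give the gaps: column `j` stands for the gap `j - (colLen j)`. -/
theorem sub_colLen_mem_gaps {mu : BarPartition} {i j : ℕ} (h : (i, j) ∈ mu.barNodes) :
    (j : ℤ) - mu.double.colLen j ∈ mu.gaps (mu.part i) := by
  have hc := lt_colLen_double h
  obtain ⟨h1, h2, h3⟩ := mem_barNodes.1 h
  have hmem : ∀ k, k < mu.double.colLen j ↔ _ := fun k =>
    YoungDiagram.mem_iff_lt_colLen.symm.trans (mu.mem_double k j)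
  rw [mem_gaps]
  rcases lt_or_ge j mu.numParts with hj | hj
  · -- a column through the diagonal gives the gap `-aⱼ`
    have e : mu.double.colLen j = j + mu.part j := by
      refine eq_of_forall_lt_iff fun k => (hmem k).trans ⟨fun h => ?_, fun h => ?_⟩
      · omega
      · rcases lt_or_ge k j with hk | hk
        · have := mu.add_part_anti hk.le hj
          have := mu.part_pos hj
          omega
        · omega
    have := mu.part_lt h2 hj
    have hp := mu.part_pos hj
    rw [e, show (j : ℤ) - (j + mu.part j : ℕ) = -(mu.part j : ℤ) by push_cast; ring,
      bead_neg_natCast mu hp, not_not]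
    exact ⟨by omega, mu.part_mem hj⟩
  · have hz := mu.part_eq_zero hj
    rw [hz] at hmem
    set k := mu.double.colLen j with hk
    have hkm : k ≤ mu.numParts := by
      by_contra hcon
      have := (hmem mu.numParts).1 (by omega)
      rw [mu.part_eq_zero le_rfl] at this
      omega
    refine ⟨by omega, fun hb => ?_⟩
    have hy0 := hb.ne_zero
    rw [show (j : ℤ) - k = (j - k : ℕ) by omega, bead_natCast mu (by omega)] at hb
    obtain ⟨t, ht, hte⟩ := mu.exists_part hb
    rcases lt_or_ge t k with h4 | h4
    · have h5 := (hmem (k - 1)).1 (by omega)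
      have h6 : mu.part (k - 1) ≤ mu.part t := by
        rcases (show t ≤ k - 1 by omega).eq_or_lt with h7 | h7
        · rw [← h7]
        · exact (mu.part_lt h7 (by omega)).le
      omega
    · have h5 : ¬ (k < k) := lt_irrefl _
      rw [hmem] at h5
      have h6 : mu.part t ≤ mu.part k := by
        rcases h4.eq_or_lt with h7 | h7
        · rw [← h7]
        · exact (mu.part_lt h7 ht).le
      omega

/-- In each row the columns give distinct gaps, and there are as many gaps as nodes in the row. -/
theorem modBarLengths_eq {d : ℕ} (hd : Odd d) (lam : BarPartition) :
    lam.modBarLengths d hd = barLengthsVia (shift d lam) (lam.barQuotientPartition d hd) := by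
  have : NeZero d := ⟨hd.pos.ne'⟩
  set q := lam.barQuotientPartition d hd with hq
  have hrows : q.barNodes.val.map (fun z => (modHookLen d lam q.double z).natAbs) =
      ∑ i ∈ Finset.range q.numParts, ∑ j ∈ Finset.Ioc i (i + q.part i),
        {(shift d lam (q.part i) - shift d lam ((j : ℤ) - q.double.colLen j)).natAbs} := by
    rw [← sum_singleton_eq_map, Finset.sum_sigma']
    refine Finset.sum_bij' (fun z _ => ⟨z.1, z.2⟩) (fun s _ => (s.1, s.2)) ?_ ?_ ?_ ?_ ?_
    · rintro ⟨i, j⟩ h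
      simpa using mem_barNodes.1 h
    · rintro ⟨i, j⟩ h
      exact mem_barNodes.2 (by simpa using h)
    · simp
    · simp
    · rintro ⟨i, j⟩ h
      simp only [modHookLen_eq lam h]
  have hrow : ∀ i ∈ Finset.range q.numParts, (∑ j ∈ Finset.Ioc i (i + q.part i),
      {(shift d lam (q.part i) - shift d lam ((j : ℤ) - q.double.colLen j)).natAbs} : Multiset ℕ) =
      (q.gaps (q.part i)).val.map fun y => (shift d lam (q.part i) - shift d lam y).natAbs := by
    intro i hi
    have hnode : ∀ j ∈ Finset.Ioc i (i + q.part i), (i, j) ∈ q.barNodes := fun j hj =>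
      mem_barNodes.2 ⟨Finset.mem_range.1 hi, Finset.mem_Ioc.1 hj⟩
    have hmaps : Set.MapsTo (fun j : ℕ => (j : ℤ) - q.double.colLen j)
        (Finset.Ioc i (i + q.part i)) (q.gaps (q.part i)) := fun j hj =>
      sub_colLen_mem_gaps (hnode j hj)
    have hinj : Set.InjOn (fun j : ℕ => (j : ℤ) - q.double.colLen j)
        (Finset.Ioc i (i + q.part i)) := by
      intro j _ j' _ hjj
      simp only at hjj
      rcases lt_trichotomy j j' with h | h | h
      · have := q.double.colLen_anti j j' h.le
        omega
      · exact h
      · have := q.double.colLen_anti j' j h.le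
        omega
    rw [← sum_singleton_eq_map]
    refine Finset.sum_nbij (fun j : ℕ => (j : ℤ) - q.double.colLen j) hmaps hinj
      (Finset.surjOn_of_injOn_of_card_le _ hmaps hinj ?_) fun j _ => rfl
    rw [card_gaps, Nat.card_Ioc]
    omega
  rw [modBarLengths, ← hq, hrows, barLengthsVia, Finset.sum_congr rfl hrow]
  refine Finset.sum_bij (fun i _ => q.part i) (fun i hi => q.part_mem (Finset.mem_range.1 hi)) ?_ ?_
    fun _ _ => rfl
  · intro i hi j hj hij
    rcases lt_trichotomy i j with h | h | h
    · exact absurd hij (q.part_lt h (Finset.mem_range.1 hj)).ne'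
    · exact h
    · exact absurd hij (q.part_lt h (Finset.mem_range.1 hi)).ne
  · intro a ha
    obtain ⟨i, hi, e⟩ := q.exists_part ha
    exact ⟨i, Finset.mem_range.2 hi, e⟩

theorem modParts_eq {d : ℕ} (hd : Odd d) (lam : BarPartition) :
    lam.modParts d hd =
      (lam.barQuotientPartition d hd).parts.image fun a : ℕ => (shift d lam a).natAbs := by
  have : NeZero d := ⟨hd.pos.ne'⟩
  set q := lam.barQuotientPartition d hd with hq
  have hlast : ∀ i < q.numParts, (i, q.numParts) ∈ q.barNodes := by
    intro i hi
    have h1 := q.add_part_anti (show i ≤ q.numParts - 1 by omega) (by omega)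
    have h2 := q.part_pos (show q.numParts - 1 < q.numParts by omega)
    exact mem_barNodes.2 ⟨hi, hi, by omega⟩
  have hcol : q.double.colLen q.numParts = q.numParts := by
    refine eq_of_forall_lt_iff fun i => ?_
    rw [← YoungDiagram.mem_iff_lt_colLen]
    constructor
    · rw [mem_double, q.part_eq_zero le_rfl]
      omega
    · exact fun hi => (YoungDiagram.mem_cells _).1 (Finset.mem_filter.1 (hlast i hi)).1
  have hval : ∀ i < q.numParts, modHookLen d lam q.double (i, q.numParts) =
      shift d lam (q.part i) := fun i hi => by
    rw [modHookLen_eq lam (hlast i hi), hcol, sub_self, shift_zero, sub_zero]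
  ext x
  simp only [modParts, ← hq, partNodes, Finset.mem_image, Finset.mem_filter, Prod.exists]
  constructor
  · rintro ⟨i, j, ⟨h1, h2⟩, rfl⟩
    subst h2
    have hi := (mem_barNodes.1 h1).1
    exact ⟨q.part i, q.part_mem hi, by rw [hval i hi]⟩
  · rintro ⟨a, ha, rfl⟩
    obtain ⟨i, hi, rfl⟩ := q.exists_part ha
    exact ⟨i, _, ⟨hlast i hi, rfl⟩, by rw [hval i hi]⟩


/-! ### Parts and bar lengths of `lam`, its core and its quotient partition -/

theorem natAbs_shift_injOn (d : ℕ) (lam mu : BarPartition) :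
    Set.InjOn (fun a : ℕ => (shift d lam a).natAbs) mu.parts := by
  intro a ha b hb h
  have ha0 := pos_of_mem_parts ha
  rcases Int.natAbs_eq_natAbs_iff.1 h with h | h
  · exact_mod_cast shift_injective d lam h
  · rw [← shift_neg] at h
    have := shift_injective d lam h
    omega

theorem modParts_val {d : ℕ} (hd : Odd d) (lam : BarPartition) :
    (lam.modParts d hd).val = (lam.barQuotientPartition d hd).parts.val.map
      fun a : ℕ => (shift d lam a).natAbs := by
  rw [modParts_eq, Finset.image_val_of_injOn (natAbs_shift_injOn d lam _)]

theorem card_modParts {d : ℕ} (hd : Odd d) (lam : BarPartition) :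
    (lam.modParts d hd).card = (lam.barQuotientPartition d hd).numParts := by
  rw [Finset.card, modParts_val, Multiset.card_map]
  rfl

/-- For `a = σ z > 0`, where `σ = shift d lam`: `a` is a part of `lam` if and only if `z` is a bead
of `q`, a part of the core if and only if `z < 0`, and a modified part if and only if `|z|` is a part
of `q`, that is, `z` is a bead when `z > 0` and a gap when `z < 0`. -/
theorem parts_eq_symmDiff {d : ℕ} (hd : Odd d) (lam : BarPartition) :
    lam.parts = symmDiff (lam.barCore d hd).parts (lam.modParts d hd) := by
  set q := lam.barQuotientPartition d hd with hq
  have hmod : ∀ {a : ℕ} {z : ℤ}, shift d lam z = a →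
      (a ∈ lam.modParts d hd ↔ z.natAbs ∈ q.parts) := by
    intro a z hz
    rw [modParts_eq, ← hq, Finset.mem_image]
    have habs : (shift d lam z.natAbs).natAbs = a := by
      rcases Int.natAbs_eq z with h | h <;> rw [h] at hz
      · omega
      · rw [shift_neg] at hz
        omega
    constructor
    · rintro ⟨b, hb, h⟩
      rw [← habs] at h
      rcases Int.natAbs_eq_natAbs_iff.1 h with h | h
      · have h2 : b = z.natAbs := by exact_mod_cast shift_injective d lam h
        rwa [← h2]
      · rw [← shift_neg] at h
        have h2 := shift_injective d lam h
        have h3 := pos_of_mem_parts hb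
        omega
    · exact fun h => ⟨_, h, habs⟩
  ext a
  rw [Finset.mem_symmDiff]
  rcases Nat.eq_zero_or_pos a with rfl | ha
  · rw [hmod (shift_zero d lam)]
    simp [zero_notMem]
  obtain ⟨z, hz⟩ := shift_surjective d lam a
  have h0 : z ≠ 0 := by
    rintro rfl
    rw [shift_zero] at hz
    omega
  rw [hmod hz, ← bead_natCast lam ha, ← bead_natCast _ ha, ← hz, bead_barCore,
    ← bead_barQuotientPartition hd, ← hq]
  rcases lt_or_gt_of_ne h0 with h | h
  · obtain ⟨b, rfl⟩ : ∃ b : ℕ, z = -b := ⟨(-z).toNat, by omega⟩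
    rw [bead_neg_natCast q (by omega), Int.natAbs_neg, Int.natAbs_natCast]
    have hb : 0 < b := by omega
    simp [hb]
  · obtain ⟨b, rfl⟩ : ∃ b : ℕ, z = b := ⟨z.toNat, by omega⟩
    rw [bead_natCast q (by omega), Int.natAbs_natCast]
    simp

theorem val_symmDiff_add {α : Type*} [DecidableEq α] (s t : Finset α) :
    (symmDiff s t).val + 2 • (s ∩ t).val = s.val + t.val := by
  ext a
  simp only [Multiset.count_add, Multiset.count_nsmul, Multiset.count_eq_of_nodup (Finset.nodup _),
    Finset.mem_val, Finset.mem_symmDiff, Finset.mem_inter]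
  by_cases h1 : a ∈ s <;> by_cases h2 : a ∈ t <;> simp [h1, h2]

/-- The bar lengths of the core and the modified bar lengths of the quotient partition make up the
bar lengths of `lam`, up to the set `I` of common parts of the two: the multiset `I` is in excess,
and the multiset `2 I` is missing. -/
theorem barLengths_add_inter {d : ℕ} (hd : Odd d) (lam : BarPartition) :
    lam.barLengths + ((lam.barCore d hd).parts ∩ lam.modParts d hd).val =
      (lam.barCore d hd).barLengths + lam.modBarLengths d hd +
        ((lam.barCore d hd).parts ∩ lam.modParts d hd).val.map (2 * ·) := by
  have hparts := val_symmDiff_add (lam.barCore d hd).parts (lam.modParts d hd)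
  rw [← parts_eq_symmDiff] at hparts
  have hdouble := congrArg (Multiset.map (2 * ·)) hparts
  simp only [Multiset.map_add, Multiset.map_nsmul] at hdouble
  have e1 := hookLengthsVia_add (w := id) (fun _ => rfl) lam
  have e2 := hookLengthsVia_add (w := id) (fun _ => rfl) (lam.barCore d hd)
  have e3 := hookLengthsVia_add (shift_neg d lam) (lam.barQuotientPartition d hd)
  rw [← modParts_val, ← modBarLengths_eq] at e3
  simp only [id, Int.natAbs_natCast, Multiset.map_id', ← barLengths_eq] at e1 e2
  have e4 := hookLengthsVia_eq hd lam
  ext l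
  have c1 := congrArg (Multiset.count l) e1
  have c2 := congrArg (Multiset.count l) e2
  have c3 := congrArg (Multiset.count l) e3
  have c4 := congrArg (Multiset.count l) e4
  have c5 := congrArg (Multiset.count l) hparts
  have c6 := congrArg (Multiset.count l) hdouble
  simp only [Multiset.count_add, Multiset.count_nsmul] at c1 c2 c3 c4 c5 c6 ⊢
  omega

end BarPartition

theorem corollary4p2 (lam : BarPartition) (d : ℕ) (hd : Odd d) (hd3 : 3 ≤ d) :
    (lam.barCore d hd).barLengths ≤ lam.barLengths ∧
    lam.modBarLengths d hd ≤ lam.barLengths ∧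
    lam.parts = symmDiff (lam.barCore d hd).parts (lam.modParts d hd) ∧
    (lam.barCore d hd).numParts + (lam.barQuotientPartition d hd).numParts =
      lam.numParts + 2 * ((lam.barCore d hd).parts ∩ lam.modParts d hd).card ∧
    (lam.barLengths = (lam.barCore d hd).barLengths + lam.modBarLengths d hd ↔
      lam.numParts = (lam.barCore d hd).numParts + (lam.barQuotientPartition d hd).numParts) := by
  have hbars := BarPartition.barLengths_add_inter hd lam
  set c := lam.barCore d hd with hc
  set P := lam.modParts d hd with hP
  have hcore : c.parts.val ≤ c.barLengths := by
    have := BarPartition.parts_map_le_barLengthsVia (w := id) rfl c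
    simpa only [id, Int.natAbs_natCast, Multiset.map_id', ← BarPartition.barLengths_eq] using this
  have hquot : P.val ≤ lam.modBarLengths d hd := by
    rw [hP, BarPartition.modParts_val, BarPartition.modBarLengths_eq]
    exact BarPartition.parts_map_le_barLengthsVia (BarPartition.shift_zero d lam) _
  have hI1 : (c.parts ∩ P).val ≤ c.barLengths :=
    (Finset.val_le_iff.2 Finset.inter_subset_left).trans hcore
  have hI2 : (c.parts ∩ P).val ≤ lam.modBarLengths d hd :=
    (Finset.val_le_iff.2 Finset.inter_subset_right).trans hquot
  have hcard : c.numParts + (lam.barQuotientPartition d hd).numParts =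
      lam.numParts + 2 * (c.parts ∩ P).card := by
    have h := congrArg Multiset.card (BarPartition.val_symmDiff_add c.parts P)
    rw [← BarPartition.parts_eq_symmDiff hd lam] at h
    simp only [Multiset.card_add, Multiset.card_nsmul, Finset.card_val] at h
    rw [hP, BarPartition.card_modParts, ← hP] at h
    exact h.symm
  refine ⟨?_, ?_, BarPartition.parts_eq_symmDiff hd lam, hcard, ?_⟩
  · refine Multiset.le_iff_count.2 fun l => ?_
    have h1 := congrArg (Multiset.count l) hbars
    have h2 := Multiset.count_le_of_le l hI2
    simp only [Multiset.count_add] at h1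
    omega
  · refine Multiset.le_iff_count.2 fun l => ?_
    have h1 := congrArg (Multiset.count l) hbars
    have h2 := Multiset.count_le_of_le l hI1
    simp only [Multiset.count_add] at h1
    omega
  · constructor
    · intro h
      rw [h] at hbars
      -- `I = 2 I` for a finite set `I` of positive integers forces `I = ∅`, by comparing the sums
      have hI := congrArg Multiset.sum (add_left_cancel hbars)
      rw [Multiset.sum_map_mul_left, Multiset.map_id'] at hI
      have hI0 : (c.parts ∩ P).val.sum = 0 := by omega
      have hempty : c.parts ∩ P = ∅ := by
        rw [Finset.eq_empty_iff_forall_notMem]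
        intro a ha
        have h0 := BarPartition.pos_of_mem_parts (Finset.mem_inter.1 ha).1
        have := Multiset.single_le_sum (fun _ _ => Nat.zero_le _) a ha
        omega
      rw [hcard, hempty, Finset.card_empty, mul_zero, add_zero]
    · intro h
      have hI : c.parts ∩ P = ∅ := Finset.card_eq_zero.1 (by omega)
      simpa [hI] using hbars
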